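/- Let $k\ge 2$ be an integer, let $\mu_k$ be the characteristic function of the $k$-free numbers (the positive integers not divisible by $d^k$ for any integer $d>1$), and for integers $n,H\ge 1$ put $$D(n,H)=\sum_{0\le h<H}\mu_k(n+h)-\frac{H}{\zeta(k)},\qquad \mathfrak{M}(x,H,\ell)=\sum_{0<n\le x}D(n,H)^{\ell},$$ where $\zeta$ is the Riemann zeta function. For every real $\varepsilon>0$ and all integers $k\ge 2$ and $\ell\ge 3$ we have, uniformly for all real $x>0$ and all integers $H\ge 1$, $$\mathfrak{M}(x,H,\ell)\ll_{\varepsilon,k,\ell} x^{\varepsilon}\left(H^{\frac{\ell}{2k}}x+H^{\ell}x^{\frac{2}{k+1}}\right),$$ where the implied constant depends at most on $\varepsilon$, $k$ and $\ell$. In particular, with $c_k=\frac{2k(k-1)}{(k+1)(2k-1)}$, we have, for all real $x>0$ and all integers $H$ with $1\le H\le x^{c_k/\ell}$, $$\mathfrak{M}(x,H,\ell)\ll_{\varepsilon,k,\ell} x^{1+\varepsilon}H^{\frac{\ell}{2k}}.$$ -/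

import Mathlib

noncomputable section

namespace KFree

/-- A positive integer `n` is `k`-free if no `k`-th power of an integer `d > 1` divides it. -/
def IsKFree (k n : ℕ) : Prop :=
  0 < n ∧ ∀ d : ℕ, 1 < d → ¬ d ^ k ∣ n

/-- The characteristic function `μ_k` of the `k`-free numbers. -/
def mu (k : ℕ) : ℕ → ℝ :=
  Set.indicator {n : ℕ | IsKFree k n} (fun _ => 1)

/-- `N(n, H) = ∑_{0 ≤ h < H} μ_k(n + h)`. -/
def N (k n H : ℕ) : ℝ :=
  ∑ h ∈ Finset.range H, mu k (n + h)

/-- The discrepancy `D(n, H) = N(n, H) - ζ(k)⁻¹ H`; the value `ζ(k)` is real for `k ≥ 2`. -/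
def D (k n H : ℕ) : ℝ :=
  N k n H - (riemannZeta (k : ℂ)).re⁻¹ * (H : ℝ)

/-- The `ℓ`-th moment `∑_{0 < n ≤ x} D(n, H) ^ ℓ`. -/
def moment (k : ℕ) (x : ℝ) (H ℓ : ℕ) : ℝ :=
  ∑ n ∈ Finset.Ioc 0 ⌊x⌋₊, D k n H ^ ℓ

/-- The exponent `c_k = 2k(k-1) / ((k+1)(2k-1))`. -/
def c (k : ℕ) : ℝ :=
  2 * (k : ℝ) * ((k : ℝ) - 1) / (((k : ℝ) + 1) * (2 * (k : ℝ) - 1))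

end KFree

end

namespace KFree
open Finset

/-! By Möbius inversion the discrepancy is `∑ μ(d) psi H (d ^ k) n`, where `psi` is the deviation of
the number of multiples of d^k in [n, n+H) from H/d^k. Cutting at B ≍ x^(2/(k+1)) costs at most
H/B^(k-1) for each n (`abs_D_sub_truncD_le`). The ℓ-th power is then expanded over tuples of
squarefree d_i; let T be their least common multiple (`radT`).

If T ≤ B, the sum over n is x times the mean over a period T^k, up to (2H)^ℓ
(`abs_sum_prod_psi_sub_le`). The heart of the proof is that this mean is ≪ H^(ℓ/2k)/T up to divisor
factors (`abs_mean_prod_psi_le`). Each `psi` splits into components `Psi` indexed by nonempty prime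
sets S_i, and a product of components has mean zero unless each prime occurs in at least two S_i.
For the surviving products, |`Psi`| is bounded by counts of multiples, and the mean of a product of
counts is estimated by adding the factors one at a time, in two opposite orders. The geometric mean
of the two estimates costs only H^(1/2k) per factor (`sq_mean_prod_cnt_le`), and a comparison of
prime exponents (`np_biUnion_sq_mul_le`) recovers the full factor 1/T. Summing over T gives H^(ℓ/2k)
x + H^ℓ B.

If T > B, absolute values suffice. With y = x^(1/(k+1)) there are pairwise coprime q_i dividing d_i
whose product q lies in [y, B], so each choice of shifts allows O(x/q^k + 1) values of n. Summing
gives H^ℓ (x/y^(k-1) + B), of order H^ℓ x^(2/(k+1)) (`sum_abs_large_le`).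

For H > x the pointwise bound D ≪ H^(1/k) is enough (`abs_moment_le_of_lt`). -/

/-! ### Divisor bound, harmonic sums and tails of ∑ d^(-k). -/

theorem two_pow_card_primeFactors_le {ε : ℝ} (hε : 0 < ε) :
    ∃ C : ℝ, 1 ≤ C ∧ ∀ n : ℕ, n ≠ 0 → (2 : ℝ) ^ #n.primeFactors ≤ C * (n : ℝ) ^ ε := by
  -- Primes p ≥ 2^(1/ε) satisfy 2 ≤ p^ε; the fewer than M smaller ones cost at most 2^M.
  obtain ⟨M, hM⟩ := exists_nat_ge ((2 : ℝ) ^ (1 / ε))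
  refine ⟨2 ^ M, one_le_pow₀ (by norm_num), fun n hn => ?_⟩
  have key : ∀ p ∈ n.primeFactors, (2 : ℝ) ≤ (if p < M then 2 else 1) * (p : ℝ) ^ ε := by
    intro p hp
    have hp1 : (1 : ℝ) ≤ p := by exact_mod_cast (Nat.prime_of_mem_primeFactors hp).one_le
    split_ifs with h
    · linarith [Real.one_le_rpow hp1 hε.le]
    · have h2 : (2 : ℝ) ^ (1 / ε) ≤ p := hM.trans (by exact_mod_cast not_lt.mp h)
      have := Real.rpow_le_rpow (by positivity) h2 hε.le
      rw [← Real.rpow_mul (by norm_num), one_div_mul_cancel hε.ne', Real.rpow_one] at this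
      linarith
  calc (2 : ℝ) ^ #n.primeFactors = ∏ p ∈ n.primeFactors, (2 : ℝ) := by simp
    _ ≤ ∏ p ∈ n.primeFactors, ((if p < M then 2 else 1) * (p : ℝ) ^ ε) :=
        prod_le_prod (fun _ _ => by norm_num) key
    _ = (∏ p ∈ n.primeFactors, if p < M then (2 : ℝ) else 1) *
          (∏ p ∈ n.primeFactors, (p : ℝ)) ^ ε := by
        rw [prod_mul_distrib, Real.finsetProd_rpow _ _ (fun _ _ => by positivity)]
    _ ≤ 2 ^ M * (n : ℝ) ^ ε := by
        gcongr
        · rw [← prod_filter, prod_const]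
          refine pow_le_pow_right₀ (by norm_num) ?_
          calc _ ≤ #(range M) := card_le_card (fun p hp => by simp at hp ⊢; exact hp.2)
            _ = M := card_range M
        · rw [← Nat.cast_prod]
          exact_mod_cast Nat.le_of_dvd (Nat.pos_of_ne_zero hn) (Nat.prod_primeFactors_dvd n)

theorem sum_Icc_inv_le {ε : ℝ} (hε : 0 < ε) :
    ∃ C : ℝ, 1 ≤ C ∧ ∀ B : ℕ, 1 ≤ B → ∑ n ∈ Icc 1 B, (n : ℝ)⁻¹ ≤ C * (B : ℝ) ^ ε := by
  refine ⟨1 + 1 / ε, by have : 0 < 1 / ε := by positivity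
                        linarith, fun B hB => ?_⟩
  have h := harmonic_le_one_add_log B
  have e : ((harmonic B : ℚ) : ℝ) = ∑ n ∈ Icc 1 B, (n : ℝ)⁻¹ := by
    rw [harmonic_eq_sum_Icc]; push_cast; rfl
  have hB' : (1 : ℝ) ≤ B := by exact_mod_cast hB
  have h1 := Real.log_le_rpow_div (x := B) (by positivity) hε
  have h2 := Real.one_le_rpow hB' hε.le
  rw [← e]
  calc _ ≤ 1 + Real.log B := h
    _ ≤ (B : ℝ) ^ ε + (B : ℝ) ^ ε / ε := by linarith
    _ = _ := by ring

theorem sum_Ioc_inv_pow_le {k : ℕ} (hk : 2 ≤ k) {B : ℕ} (hB : 1 ≤ B) (M : ℕ) :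
    ∑ d ∈ Ioc B M, ((d : ℝ) ^ k)⁻¹ ≤ ((B : ℝ) ^ (k - 1))⁻¹ := by
  rcases le_or_gt M B with h | h
  · rw [Ioc_eq_empty (by omega)]; simp
  have hB' : (1 : ℝ) ≤ B := by exact_mod_cast hB
  have h1 := sum_Ioc_inv_sq_le_sub (α := ℝ) (k := B) (n := M) (by omega) h.le
  calc ∑ d ∈ Ioc B M, ((d : ℝ) ^ k)⁻¹ ≤ ∑ d ∈ Ioc B M, ((B : ℝ) ^ (k - 2))⁻¹ * ((d : ℝ) ^ 2)⁻¹ := by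
        refine sum_le_sum fun d hd => ?_
        have hd1 : (B : ℝ) ≤ d := by exact_mod_cast (mem_Ioc.mp hd).1.le
        have hd0 : (0 : ℝ) < d := by linarith
        rw [← mul_inv]
        refine inv_anti₀ (by positivity) ?_
        calc (B : ℝ) ^ (k - 2) * (d : ℝ) ^ 2 ≤ (d : ℝ) ^ (k - 2) * (d : ℝ) ^ 2 := by gcongr
          _ = _ := by rw [← pow_add]; congr 1; omega
    _ = ((B : ℝ) ^ (k - 2))⁻¹ * ∑ d ∈ Ioc B M, ((d : ℝ) ^ 2)⁻¹ := by rw [mul_sum]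
    _ ≤ ((B : ℝ) ^ (k - 2))⁻¹ * (B : ℝ)⁻¹ := by
        gcongr
        exact h1.trans (by linarith [show (0 : ℝ) ≤ (M : ℝ)⁻¹ by positivity])
    _ = _ := by rw [← mul_inv, ← pow_succ]; congr 3; omega

theorem sum_Icc_inv_pow_le {k : ℕ} (hk : 2 ≤ k) (M : ℕ) :
    ∑ d ∈ Icc 1 M, ((d : ℝ) ^ k)⁻¹ ≤ 2 := by
  rcases Nat.eq_zero_or_pos M with rfl | h
  · simp
  rw [← add_sum_Ioc_eq_sum_Icc h]
  have := sum_Ioc_inv_pow_le hk le_rfl M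
  simp only [Nat.cast_one, one_pow, inv_one] at this ⊢
  linarith

/-! ### Means of periodic functions and simultaneous divisibility. -/

/-- The mean of `f` over `0 ≤ n < Q`. -/
noncomputable def mean (Q : ℕ) (f : ℕ → ℝ) : ℝ := (∑ n ∈ range Q, f n) / Q

theorem mean_sum {ι : Type*} (Q : ℕ) (s : Finset ι) (f : ι → ℕ → ℝ) :
    mean Q (fun n => ∑ i ∈ s, f i n) = ∑ i ∈ s, mean Q (f i) := by
  simp only [mean, ← sum_div]
  rw [sum_comm]

theorem mean_const_mul (Q : ℕ) (c : ℝ) (f : ℕ → ℝ) :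
    mean Q (fun n => c * f n) = c * mean Q f := by
  simp only [mean, ← mul_sum, mul_div_assoc]

theorem mean_mono {Q : ℕ} {f g : ℕ → ℝ} (h : ∀ n, f n ≤ g n) : mean Q f ≤ mean Q g := by
  unfold mean; gcongr with n; exact h n

theorem mean_nonneg {Q : ℕ} {f : ℕ → ℝ} (h : ∀ n, 0 ≤ f n) : 0 ≤ mean Q f := by
  unfold mean; exact div_nonneg (sum_nonneg fun n _ => h n) (by positivity)

theorem abs_mean_le (Q : ℕ) (f : ℕ → ℝ) : |mean Q f| ≤ mean Q (fun n => |f n|) := by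
  unfold mean
  rw [abs_div, Nat.abs_cast]
  gcongr
  exact abs_sum_le_sum_abs _ _

theorem sum_range_mul_of_periodic {f : ℕ → ℝ} {a : ℕ} (hf : Function.Periodic f a) (q : ℕ) :
    ∑ n ∈ range (a * q), f n = q * ∑ n ∈ range a, f n := by
  induction q with
  | zero => simp
  | succ q ih =>
    rw [Nat.mul_succ, sum_range_add, ih]
    have : ∀ x ∈ range a, f (a * q + x) = f x := by
      intro x _
      have := hf.nat_mul q x
      rw [add_comm, mul_comm a]; simpa using this
    rw [sum_congr rfl this]; push_cast; ring

theorem mean_eq_of_dvd {f : ℕ → ℝ} {a Q : ℕ} (hf : Function.Periodic f a) (h : a ∣ Q)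
    (hQ : Q ≠ 0) : mean Q f = mean a f := by
  obtain ⟨q, rfl⟩ := h
  have ha : (a : ℝ) ≠ 0 := by rintro h; simp_all
  have hq : (q : ℝ) ≠ 0 := by rintro h; simp_all
  unfold mean
  rw [sum_range_mul_of_periodic hf]; push_cast; field_simp

/-- The indicator function of `c ∣ m`. -/
noncomputable def ind (c m : ℕ) : ℝ := if c ∣ m then 1 else 0

theorem ind_nonneg (c m : ℕ) : 0 ≤ ind c m := by unfold ind; split_ifs <;> norm_num

theorem periodic_ind {c M : ℕ} (h : c ∣ M) (b : ℕ) :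
    Function.Periodic (fun n => ind c (n + b)) M := by
  intro n
  have : n + M + b = M + (n + b) := by ring
  simp only [ind, this, Nat.dvd_add_right h]

theorem sum_mul_ind_of_coprime {f : ℕ → ℝ} {a m : ℕ} (hf : Function.Periodic f a)
    (ha : a ≠ 0) (hm : m ≠ 0) (co : a.Coprime m) (b : ℕ) :
    ∑ n ∈ range (a * m), f n * ind m (n + b) = ∑ n ∈ range a, f n := by
  have : ∀ n, f n * ind m (n + b) = if m ∣ n + b then f n else 0 := by
    intro n; simp [ind]
  simp only [this]
  rw [← sum_filter]
  refine sum_bij (fun n _ => n % a) ?_ ?_ ?_ ?_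
  · intro n _; exact mem_range.mpr (Nat.mod_lt _ (Nat.pos_of_ne_zero ha))
  · intro n hn n' hn' h
    simp only [mem_filter, mem_range] at hn hn'
    have h1 : n ≡ n' [MOD a] := h
    have h2 : n ≡ n' [MOD m] := by
      have : n + b ≡ n' + b [MOD m] :=
        ((Nat.modEq_zero_iff_dvd.mpr hn.2).trans (Nat.modEq_zero_iff_dvd.mpr hn'.2).symm)
      exact Nat.ModEq.add_right_cancel' b this
    exact Nat.ModEq.eq_of_lt_of_lt ((Nat.modEq_and_modEq_iff_modEq_mul co).mp ⟨h1, h2⟩) hn.1 hn'.1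
  · intro i hi
    have hi' := mem_range.mp hi
    -- `m - b % m` represents -b modulo m within the natural numbers.
    let c := Nat.chineseRemainder co i (m - b % m)
    refine ⟨c, ?_, ?_⟩
    · simp only [mem_filter, mem_range]
      refine ⟨Nat.chineseRemainder_lt_mul co _ _ ha hm, ?_⟩
      have h2 : (c : ℕ) ≡ m - b % m [MOD m] := c.2.2
      refine Nat.modEq_zero_iff_dvd.mp ?_
      calc (c : ℕ) + b ≡ (m - b % m) + b % m [MOD m] := h2.add (Nat.mod_modEq b m).symm
        _ ≡ 0 [MOD m] := by
            rw [Nat.sub_add_cancel (Nat.mod_lt _ (Nat.pos_of_ne_zero hm)).le]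
            exact Nat.modEq_zero_iff_dvd.mpr dvd_rfl
    · have h1 : (c : ℕ) % a = i % a := c.2.1
      change (c : ℕ) % a = i
      rw [h1, Nat.mod_eq_of_lt hi']
  · intro n _
    exact (hf.map_mod_nat n).symm

/-- Independence of coprime moduli, from the Chinese remainder theorem. -/
theorem mean_mul_ind {f : ℕ → ℝ} {a m Q : ℕ} (hf : Function.Periodic f a)
    (co : a.Coprime m) (hQ : Q ≠ 0) (h : a * m ∣ Q) (b : ℕ) :
    mean Q (fun n => f n * ind m (n + b)) = mean Q f / m := by
  have h0 : a * m ≠ 0 := fun h' => hQ (by rw [h'] at h; exact zero_dvd_iff.mp h)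
  have ha : a ≠ 0 := left_ne_zero_of_mul h0
  have hm : m ≠ 0 := right_ne_zero_of_mul h0
  have hp : Function.Periodic (fun n => f n * ind m (n + b)) (a * m) := by
    have h1 : Function.Periodic f (a * m) := by
      rw [mul_comm]; exact_mod_cast hf.nat_mul m
    exact h1.mul (periodic_ind (dvd_mul_left m a) b)
  rw [mean_eq_of_dvd hp h hQ, mean_eq_of_dvd hf ((dvd_mul_right a m).trans h) hQ]
  unfold mean
  rw [sum_mul_ind_of_coprime hf ha hm co]
  push_cast
  rw [div_div]

theorem abs_sum_range_sub_mean_le {f : ℕ → ℝ} {M : ℕ} (hM : M ≠ 0) (hf : Function.Periodic f M)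
    (h0 : ∀ n, 0 ≤ f n) (X : ℕ) :
    |∑ n ∈ range X, f n - X * mean M f| ≤ ∑ n ∈ range M, f n := by
  have hX : X = M * (X / M) + X % M := (Nat.div_add_mod X M).symm
  set q := X / M
  set r := X % M
  have hr : r < M := Nat.mod_lt _ (Nat.pos_of_ne_zero hM)
  have hMr : (M : ℝ) ≠ 0 := by exact_mod_cast hM
  have e1 : ∑ n ∈ range X, f n = q * (∑ n ∈ range M, f n) + ∑ n ∈ range r, f n := by
    rw [hX, sum_range_add, sum_range_mul_of_periodic hf]
    congr 1
    refine sum_congr rfl fun x _ => ?_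
    have := hf.nat_mul q x
    rw [add_comm, mul_comm M]; simpa using this
  have e2 : (X : ℝ) * mean M f = q * (∑ n ∈ range M, f n) + (r / M) * ∑ n ∈ range M, f n := by
    have : (X : ℝ) = M * q + r := by exact_mod_cast hX
    rw [this]; unfold mean; field_simp
  have hF : 0 ≤ ∑ n ∈ range M, f n := sum_nonneg fun n _ => h0 n
  have h3 : ∑ n ∈ range r, f n ≤ ∑ n ∈ range M, f n :=
    sum_le_sum_of_subset_of_nonneg (range_mono hr.le) fun n _ _ => h0 n
  have h4 : 0 ≤ ∑ n ∈ range r, f n := sum_nonneg fun n _ => h0 n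
  have h5 : (r / M : ℝ) ≤ 1 := by
    rw [div_le_one (by positivity)]; exact_mod_cast hr.le
  have h6 : (0 : ℝ) ≤ r / M := by positivity
  rw [e1, e2, abs_le]
  constructor <;> nlinarith

/-- Two solutions differ by a common multiple of the `c i`, hence by a multiple of M. -/
theorem sum_prod_ind_le_one {ι : Type*} (K : Finset ι) (c b : ι → ℕ) {M : ℕ}
    (h : ∀ z : ℤ, (∀ i ∈ K, (c i : ℤ) ∣ z) → (M : ℤ) ∣ z) :
    ∑ n ∈ range M, ∏ i ∈ K, ind (c i) (n + b i) ≤ 1 := by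
  classical
  have e : ∀ n, ∏ i ∈ K, ind (c i) (n + b i) = if ∀ i ∈ K, c i ∣ n + b i then 1 else 0 := by
    intro n
    split_ifs with h
    · exact prod_eq_one fun i hi => by simp [ind, h i hi]
    · push Not at h
      obtain ⟨i, hi, h⟩ := h
      exact prod_eq_zero hi (by simp [ind, h])
  simp only [e]
  rw [← sum_filter, sum_const, nsmul_eq_mul, mul_one]
  norm_cast
  refine card_le_one.mpr fun n hn n' hn' => ?_
  simp only [mem_filter, mem_range] at hn hn'
  have h1 : (M : ℤ) ∣ (n' : ℤ) - n := by
    refine h _ fun i hi => ?_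
    have h2 : (c i : ℤ) ∣ ((n + b i : ℕ) : ℤ) := by exact_mod_cast hn.2 i hi
    have h3 : (c i : ℤ) ∣ ((n' + b i : ℕ) : ℤ) := by exact_mod_cast hn'.2 i hi
    have := dvd_sub h3 h2
    push_cast at this
    simpa using this
  exact Nat.ModEq.eq_of_lt_of_lt ((Nat.modEq_iff_dvd).mpr h1) hn.1 hn'.1

/-- Counting solutions of simultaneous divisibility conditions `c i ∣ n + b i`. -/
theorem abs_sum_prod_ind_sub_le {ι : Type*} (K : Finset ι) (c b : ι → ℕ) {M : ℕ} (hM : M ≠ 0)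
    (hc : ∀ i ∈ K, c i ∣ M) (h : ∀ z : ℤ, (∀ i ∈ K, (c i : ℤ) ∣ z) → (M : ℤ) ∣ z) (X : ℕ) :
    |∑ n ∈ range X, ∏ i ∈ K, ind (c i) (n + b i) -
      X * mean M (fun n => ∏ i ∈ K, ind (c i) (n + b i))| ≤ 1 := by
  have hp : Function.Periodic (fun n => ∏ i ∈ K, ind (c i) (n + b i)) M := by
    intro n
    exact prod_congr rfl fun i hi => periodic_ind (hc i hi) (b i) n
  exact (abs_sum_range_sub_mean_le hM hp
    (fun n => prod_nonneg fun i _ => ind_nonneg _ _) X).trans (sum_prod_ind_le_one K c b h)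

theorem sum_prod_ind_le {ι : Type*} (K : Finset ι) (c b : ι → ℕ) {M : ℕ} (hM : M ≠ 0)
    (hc : ∀ i ∈ K, c i ∣ M) (h : ∀ z : ℤ, (∀ i ∈ K, (c i : ℤ) ∣ z) → (M : ℤ) ∣ z) (X : ℕ) :
    ∑ n ∈ range X, ∏ i ∈ K, ind (c i) (n + b i) ≤ X / M + 1 := by
  have h1 := (abs_le.mp (abs_sum_prod_ind_sub_le K c b hM hc h X)).2
  have h2 : mean M (fun n => ∏ i ∈ K, ind (c i) (n + b i)) ≤ 1 / M := by
    unfold mean; gcongr; exact sum_prod_ind_le_one K c b h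
  have h3 : (X : ℝ) * mean M (fun n => ∏ i ∈ K, ind (c i) (n + b i)) ≤ X / M := by
    calc _ ≤ (X : ℝ) * (1 / M) := by gcongr
      _ = _ := by ring
  linarith

theorem abs_sum_ind_sub_le {c : ℕ} (hc : c ≠ 0) (b H : ℕ) :
    |∑ h ∈ range H, ind c (b + h) - H / c| ≤ 1 := by
  have := abs_sum_prod_ind_sub_le (univ : Finset Unit) (fun _ => c) (fun _ => b) hc
    (fun _ _ => dvd_rfl) (fun z hz => hz () (mem_univ _)) H
  simp only [univ_unique, prod_singleton] at this
  have e : mean c (fun n => ind c (n + b)) = 1 / c := by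
    have := mean_mul_ind (f := fun _ => 1) (a := 1) (m := c) (Q := c) (fun _ => rfl)
      (Nat.coprime_one_left c) hc (by simp) b
    simp only [one_mul] at this
    rw [this]
    unfold mean
    have : (c : ℝ) ≠ 0 := by exact_mod_cast hc
    simp [this]
  rw [e, mul_one_div] at this
  simpa [add_comm] using this

/-! ### Squarefree numbers as prime sets, and counts of multiples. -/

/-- The product of a finite set of (prime) numbers. -/
def np (A : Finset ℕ) : ℕ := ∏ p ∈ A, p

theorem np_pos {A : Finset ℕ} (hA : ∀ p ∈ A, p.Prime) : 0 < np A :=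
  prod_pos fun p hp => (hA p hp).pos

theorem one_le_np {A : Finset ℕ} (hA : ∀ p ∈ A, p.Prime) : (1 : ℝ) ≤ np A := by
  exact_mod_cast np_pos hA

theorem np_mono {A B : Finset ℕ} (h : A ⊆ B) (hB : ∀ p ∈ B, p.Prime) : np A ≤ np B :=
  prod_le_prod_of_subset_of_one_le' h fun p hp _ => (hB p hp).one_le

theorem np_union_le {A B : Finset ℕ} (hA : ∀ p ∈ A, p.Prime) :
    np (A ∪ B) ≤ np A * np B := by
  have : np A * np B = np (A ∪ B) * np (A ∩ B) := prod_union_inter.symm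
  rw [this]
  exact Nat.le_mul_of_pos_right _ (np_pos fun p hp => hA p (mem_inter.mp hp).1)

theorem np_union_of_disjoint {A B : Finset ℕ} (h : Disjoint A B) :
    np (A ∪ B) = np A * np B := prod_union h

theorem np_inter_mul_np_sdiff (A B : Finset ℕ) : np (A ∩ B) * np (A \ B) = np A := by
  unfold np; rw [prod_inter_mul_prod_sdiff]

theorem np_sdiff_mul {A B : Finset ℕ} (h : B ⊆ A) : np (A \ B) * np B = np A :=
  prod_sdiff h

theorem np_coprime {A B : Finset ℕ} (hA : ∀ p ∈ A, p.Prime) (hB : ∀ p ∈ B, p.Prime)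
    (h : Disjoint A B) : (np A).Coprime (np B) :=
  Nat.Coprime.prod_left fun p hp => Nat.Coprime.prod_right fun q hq =>
    (Nat.coprime_primes (hA p hp) (hB q hq)).mpr fun e => (disjoint_left.mp h hp) (e ▸ hq)

theorem np_dvd {A B : Finset ℕ} (h : A ⊆ B) : np A ∣ np B := prod_dvd_prod_of_subset _ _ _ h

theorem ind_mul_of_coprime {a b : ℕ} (h : a.Coprime b) (m : ℕ) :
    ind (a * b) m = ind a m * ind b m := by
  unfold ind
  have : a * b ∣ m ↔ a ∣ m ∧ b ∣ m :=
    ⟨fun h' => ⟨(dvd_mul_right a b).trans h', (dvd_mul_left b a).trans h'⟩,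
      fun h' => h.mul_dvd_of_dvd_of_dvd h'.1 h'.2⟩
  by_cases ha : a ∣ m <;> by_cases hb : b ∣ m <;> simp [this, ha, hb]

theorem ind_np_pow {A : Finset ℕ} (hA : ∀ p ∈ A, p.Prime) (k m : ℕ) :
    ind (np A ^ k) m = ∏ p ∈ A, ind (p ^ k) m := by
  induction A using Finset.induction_on with
  | empty => simp [np, ind]
  | insert a s ha ih =>
    have hs : ∀ p ∈ s, p.Prime := fun p hp => hA p (mem_insert_of_mem hp)
    have : np (insert a s) = a * np s := prod_insert ha
    rw [this, mul_pow, ind_mul_of_coprime, ih hs, prod_insert ha]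
    refine Nat.Coprime.pow _ _ ?_
    have := np_coprime (A := {a}) (B := s) (by simpa using hA a (mem_insert_self _ _)) hs
      (by simpa using ha)
    simpa [np] using this

/-- The number of multiples of `c` among `n, …, n + H - 1`. -/
noncomputable def cnt (H c n : ℕ) : ℝ := ∑ h ∈ range H, ind c (n + h)

/-- The deviation of `cnt` from its mean. -/
noncomputable def psi (H c n : ℕ) : ℝ := cnt H c n - H / c

theorem cnt_nonneg (H c n : ℕ) : 0 ≤ cnt H c n := sum_nonneg fun _ _ => ind_nonneg _ _

theorem abs_psi_le_one {c : ℕ} (hc : c ≠ 0) (H n : ℕ) : |psi H c n| ≤ 1 :=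
  abs_sum_ind_sub_le hc n H

theorem cnt_le {c : ℕ} (hc : c ≠ 0) (H n : ℕ) : cnt H c n ≤ 1 + H / c := by
  have := (abs_le.mp (abs_psi_le_one hc H n)).2
  unfold psi at this; linarith

theorem abs_psi_le_cnt_add (H c n : ℕ) : |psi H c n| ≤ cnt H c n + H / c := by
  unfold psi
  have h1 := cnt_nonneg H c n
  have h2 : (0 : ℝ) ≤ H / c := by positivity
  rw [abs_le]; constructor <;> linarith

theorem periodic_cnt {c M : ℕ} (h : c ∣ M) (H : ℕ) : Function.Periodic (cnt H c) M := by
  intro n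
  exact sum_congr rfl fun b _ => periodic_ind h b n

/-! ### Means of products of counts. -/

/-- The primes of `A i` split into old ones G and new ones V. The condition at V is independent of
everything else and contributes V^(-k); the condition at G is kept only through the pointwise bound
1 + H/G^k for the number of shifts. -/
theorem mean_prod_cnt_insert_le {ι : Type*} [DecidableEq ι] {K : Finset ι} {i : ι} (hi : i ∉ K)
    {A : ι → Finset ℕ} (hA : ∀ i, ∀ p ∈ A i, p.Prime) (k H : ℕ) {Q : ℕ} (hQ : Q ≠ 0)
    (hd : np ((insert i K).biUnion A) ^ k ∣ Q) :
    mean Q (fun n => ∏ j ∈ insert i K, cnt H (np (A j) ^ k) n) ≤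
      mean Q (fun n => ∏ j ∈ K, cnt H (np (A j) ^ k) n) *
        ((1 + H / (np (A i ∩ K.biUnion A) : ℝ) ^ k) / (np (A i \ K.biUnion A) : ℝ) ^ k) := by
  set U := K.biUnion A with hU
  set G := A i ∩ U with hG
  set V := A i \ U with hV
  have hUp : ∀ p ∈ U, p.Prime := by
    intro p hp; obtain ⟨j, _, hj⟩ := mem_biUnion.mp hp; exact hA j p hj
  have hGp : ∀ p ∈ G, p.Prime := fun p hp => hUp p (mem_inter.mp hp).2
  have hVp : ∀ p ∈ V, p.Prime := fun p hp => hA i p (mem_sdiff.mp hp).1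
  have hVU : Disjoint U V := disjoint_sdiff
  have hGV : Disjoint G V := hVU.mono_left inter_subset_right
  set f : ℕ → ℝ := fun n => ∏ j ∈ K, cnt H (np (A j) ^ k) n with hf
  have hfp : Function.Periodic f (np U ^ k) := by
    intro n
    exact prod_congr rfl fun j hj =>
      periodic_cnt (pow_dvd_pow_of_dvd (np_dvd (subset_biUnion_of_mem A hj)) k) H n
  have hf0 : ∀ n, 0 ≤ f n := fun n => prod_nonneg fun j _ => cnt_nonneg _ _ _
  have hsplit : ∀ m, ind (np (A i) ^ k) m = ind (np G ^ k) m * ind (np V ^ k) m := by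
    intro m
    rw [← np_inter_mul_np_sdiff (A i) U, mul_pow, ind_mul_of_coprime]
    exact Nat.Coprime.pow _ _ (np_coprime hGp hVp hGV)
  have hdvd : np U ^ k * np V ^ k ∣ Q := by
    rw [← mul_pow, ← np_union_of_disjoint hVU]
    refine (pow_dvd_pow_of_dvd (np_dvd ?_) k).trans hd
    rw [biUnion_insert, hV, union_sdiff_self_eq_union, union_comm]
  have hg0 : np G ^ k ≠ 0 := pow_ne_zero _ (np_pos hGp).ne'
  calc mean Q (fun n => ∏ j ∈ insert i K, cnt H (np (A j) ^ k) n)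
      = mean Q (fun n => ∑ h ∈ range H, (f n * ind (np G ^ k) (n + h)) * ind (np V ^ k) (n + h)) := by
        congr 1; ext n
        rw [prod_insert hi, cnt, sum_mul]
        refine sum_congr rfl fun h _ => ?_
        rw [hsplit]; ring
    _ = ∑ h ∈ range H, mean Q (fun n => f n * ind (np G ^ k) (n + h)) / (np V : ℝ) ^ k := by
        rw [mean_sum]
        refine sum_congr rfl fun h _ => ?_
        have := mean_mul_ind (a := np U ^ k) (hfp.mul (periodic_ind
          (pow_dvd_pow_of_dvd (np_dvd inter_subset_right) k) h))
          (Nat.Coprime.pow k k (np_coprime hUp hVp hVU)) hQ hdvd h (f := fun n =>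
            f n * ind (np G ^ k) (n + h))
        rw [this]
        push_cast; rfl
    _ = mean Q (fun n => f n * cnt H (np G ^ k) n) / (np V : ℝ) ^ k := by
        rw [← sum_div, ← mean_sum]
        simp only [cnt, mul_sum]
    _ ≤ mean Q (fun n => (1 + H / (np G : ℝ) ^ k) * f n) / (np V : ℝ) ^ k := by
        gcongr
        refine mean_mono fun n => ?_
        have := cnt_le hg0 H n
        push_cast at this
        rw [mul_comm]
        exact mul_le_mul_of_nonneg_right this (hf0 n)
    _ = _ := by rw [mean_const_mul]; ring

/-- Since max(1, P/g) ≤ t, the k-th power of max(1, P/g)/t may be replaced by its first power. -/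
theorem one_add_pow_div_le {P g t : ℝ} {k : ℕ} (hk : k ≠ 0) (hP : 0 ≤ P) (hg : 1 ≤ g)
    (ht : 1 ≤ t) (h : P ≤ g * t) :
    (1 + P ^ k / g ^ k) / t ^ k ≤ 2 * max 1 (P / g) / t := by
  have h1 : P / g ≤ max 1 (P / g) := le_max_right _ _
  have h2 : 1 ≤ max 1 (P / g) := le_max_left _ _
  have h3 : max 1 (P / g) ≤ t := max_le ht (by rw [div_le_iff₀ (by linarith)]; linarith)
  set m := max 1 (P / g)
  have h4 : 1 + P ^ k / g ^ k ≤ 2 * m ^ k := by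
    rw [← div_pow]
    have : (P / g) ^ k ≤ m ^ k := by gcongr
    have := one_le_pow₀ h2 (n := k)
    linarith
  calc (1 + P ^ k / g ^ k) / t ^ k ≤ 2 * m ^ k / t ^ k := by gcongr
    _ = 2 * (m / t) ^ k := by rw [div_pow]; ring
    _ ≤ 2 * (m / t) := by
        gcongr
        exact pow_le_of_le_one (by positivity) (by rw [div_le_one (by linarith)]; exact h3) hk
    _ = _ := by ring

/-- The source of the square-root saving: the two orders of insertion together cost P u instead of
P². The lower bound for g g' u is needed only when both maxima are the ratios. -/
theorem max_mul_max_le {P g g' u : ℝ} (hP : 1 ≤ P) (hg : 1 ≤ g) (hg' : 1 ≤ g') (hu : 1 ≤ u)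
    (h : P ≤ g * g' * u) : max 1 (P / g) * max 1 (P / g') ≤ P * u := by
  have a1 : P / g ≤ P := div_le_self (by linarith) hg
  have a2 : P / g' ≤ P := div_le_self (by linarith) hg'
  have a3 : P ≤ P * u := by nlinarith
  rcases max_cases 1 (P / g) with ⟨e, _⟩ | ⟨e, _⟩ <;>
  rcases max_cases 1 (P / g') with ⟨e', _⟩ | ⟨e', _⟩ <;> rw [e, e']
  · linarith
  · linarith
  · linarith
  · rw [div_mul_div_comm, div_le_iff₀ (by positivity)]
    nlinarith [mul_le_mul_of_nonneg_left h (by linarith : 0 ≤ P)]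

theorem mean_one_le (Q : ℕ) : mean Q (fun _ => 1) ≤ 1 := by
  simp only [mean, sum_const, card_range, nsmul_eq_mul, mul_one]
  exact div_self_le_one _

section
variable {ι : Type*} [LinearOrder ι] {A : ι → Finset ℕ} {k H Q : ℕ} {P : ℝ}

theorem mean_prod_cnt_insert_le_max {K : Finset ι} {i : ι} (hi : i ∉ K)
    (hA : ∀ i, ∀ p ∈ A i, p.Prime) (hk : k ≠ 0) (hP : 1 ≤ P) (hPH : P ^ k = H) (hQ : Q ≠ 0)
    (hPi : P < np (A i)) (hd : np ((insert i K).biUnion A) ^ k ∣ Q) {C : ℝ}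
    (h : mean Q (fun n => ∏ j ∈ K, cnt H (np (A j) ^ k) n) ≤ C / np (K.biUnion A)) :
    mean Q (fun n => ∏ j ∈ insert i K, cnt H (np (A j) ^ k) n) ≤
      (2 * max 1 (P / np (A i ∩ K.biUnion A)) * C) / np ((insert i K).biUnion A) := by
  have hG : ∀ p ∈ A i ∩ K.biUnion A, p.Prime := fun p hp => hA i p (mem_inter.mp hp).1
  have hV : ∀ p ∈ A i \ K.biUnion A, p.Prime := fun p hp => hA i p (mem_sdiff.mp hp).1
  have e : np ((insert i K).biUnion A) = np (K.biUnion A) * np (A i \ K.biUnion A) := by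
    rw [← np_union_of_disjoint disjoint_sdiff, biUnion_insert, union_sdiff_self_eq_union,
      union_comm]
  have h1 := mean_prod_cnt_insert_le hi hA k H hQ hd
  have h2 : P ≤ (np (A i ∩ K.biUnion A) : ℝ) * np (A i \ K.biUnion A) := by
    have : (np (A i) : ℝ) = (np (A i ∩ K.biUnion A) : ℝ) * np (A i \ K.biUnion A) := by
      exact_mod_cast (np_inter_mul_np_sdiff (A i) (K.biUnion A)).symm
    linarith
  have h3 := one_add_pow_div_le hk (by linarith) (one_le_np hG) (one_le_np hV) h2
  rw [hPH] at h3
  refine h1.trans ?_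
  calc _ ≤ (C / np (K.biUnion A)) *
        (2 * max 1 (P / np (A i ∩ K.biUnion A)) / np (A i \ K.biUnion A)) := by
        refine mul_le_mul h h3 (by positivity) ?_
        exact (mean_nonneg fun n => prod_nonneg fun j _ => cnt_nonneg _ _ _).trans h
    _ = _ := by rw [e]; push_cast; rw [div_mul_div_comm]; ring

theorem mean_prod_cnt_le_lt (hA : ∀ i, ∀ p ∈ A i, p.Prime) (hk : k ≠ 0) (hP : 1 ≤ P)
    (hPH : P ^ k = H) (hQ : Q ≠ 0) (K : Finset ι) (hPi : ∀ i ∈ K, P < np (A i))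
    (hd : np (K.biUnion A) ^ k ∣ Q) :
    mean Q (fun n => ∏ j ∈ K, cnt H (np (A j) ^ k) n) ≤
      (∏ i ∈ K, 2 * max 1 (P / np (A i ∩ (K.filter (· < i)).biUnion A))) / np (K.biUnion A) := by
  induction K using Finset.induction_on_max with
  | empty => simpa [np] using mean_one_le Q
  | insert a s ha ih =>
    have has : a ∉ s := fun h => lt_irrefl _ (ha a h)
    have hs : np (s.biUnion A) ^ k ∣ Q :=
      (pow_dvd_pow_of_dvd (np_dvd (biUnion_subset_biUnion_of_subset_left A (subset_insert a s)))
        k).trans hd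
    have := mean_prod_cnt_insert_le_max has hA hk hP hPH hQ (hPi a (mem_insert_self _ _)) hd
      (ih (fun i hi => hPi i (mem_insert_of_mem hi)) hs)
    rw [prod_insert has]
    have e1 : (insert a s).filter (· < a) = s := by
      ext x; simp only [mem_filter, mem_insert]
      exact ⟨fun h => h.1.resolve_left h.2.ne, fun h => ⟨Or.inr h, ha x h⟩⟩
    have e2 : ∀ i ∈ s, (insert a s).filter (· < i) = s.filter (· < i) := by
      intro i hi
      rw [filter_insert, if_neg (ha i hi).not_gt]
    rw [e1, prod_congr rfl fun i hi => by rw [e2 i hi]]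
    exact this

theorem mean_prod_cnt_le_gt (hA : ∀ i, ∀ p ∈ A i, p.Prime) (hk : k ≠ 0) (hP : 1 ≤ P)
    (hPH : P ^ k = H) (hQ : Q ≠ 0) (K : Finset ι) (hPi : ∀ i ∈ K, P < np (A i))
    (hd : np (K.biUnion A) ^ k ∣ Q) :
    mean Q (fun n => ∏ j ∈ K, cnt H (np (A j) ^ k) n) ≤
      (∏ i ∈ K, 2 * max 1 (P / np (A i ∩ (K.filter (i < ·)).biUnion A))) / np (K.biUnion A) :=
  -- Reversing the order of the index type reverses the order of insertion.
  mean_prod_cnt_le_lt (ι := ιᵒᵈ) hA hk hP hPH hQ K hPi hd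

/-- The increasing and decreasing estimates are multiplied. Every prime of `A i` is shared with an
earlier index, shared with a later one, or private to i, so `max_mul_max_le` applies with u the
product of the private primes. -/
theorem sq_mean_prod_cnt_le (hA : ∀ i, ∀ p ∈ A i, p.Prime) (hk : k ≠ 0) (hP : 1 ≤ P)
    (hPH : P ^ k = H) (hQ : Q ≠ 0) (K : Finset ι) (hPi : ∀ i ∈ K, P < np (A i))
    (hd : np (K.biUnion A) ^ k ∣ Q) :
    mean Q (fun n => ∏ j ∈ K, cnt H (np (A j) ^ k) n) ^ 2 ≤
      (∏ i ∈ K, (4 * P * np (A i \ (K.erase i).biUnion A))) / (np (K.biUnion A) : ℝ) ^ 2 := by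
  have h1 := mean_prod_cnt_le_lt hA hk hP hPH hQ K hPi hd
  have h2 := mean_prod_cnt_le_gt hA hk hP hPH hQ K hPi hd
  have h0 : 0 ≤ mean Q (fun n => ∏ j ∈ K, cnt H (np (A j) ^ k) n) :=
    mean_nonneg fun n => prod_nonneg fun j _ => cnt_nonneg _ _ _
  rw [sq]
  refine (mul_le_mul h1 h2 h0 (h0.trans h1)).trans ?_
  rw [div_mul_div_comm, ← sq, ← prod_mul_distrib]
  refine div_le_div_of_nonneg_right (prod_le_prod (fun _ _ => by positivity) fun i hi => ?_)
    (by positivity)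
  set G := A i ∩ (K.filter (· < i)).biUnion A
  set G' := A i ∩ (K.filter (i < ·)).biUnion A
  set V := A i \ (K.erase i).biUnion A
  have hG : ∀ p ∈ G, p.Prime := fun p hp => hA i p (mem_inter.mp hp).1
  have hG' : ∀ p ∈ G', p.Prime := fun p hp => hA i p (mem_inter.mp hp).1
  have hV : ∀ p ∈ V, p.Prime := fun p hp => hA i p (mem_sdiff.mp hp).1
  have hcov : A i ⊆ (G ∪ G') ∪ V := by
    intro p hp
    by_cases hpv : p ∈ (K.erase i).biUnion A
    · obtain ⟨j, hj, hpj⟩ := mem_biUnion.mp hpv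
      obtain ⟨hji, hjK⟩ := mem_erase.mp hj
      rcases lt_or_gt_of_ne hji with h | h
      · exact mem_union_left _ (mem_union_left _ (mem_inter.mpr ⟨hp, mem_biUnion.mpr
          ⟨j, mem_filter.mpr ⟨hjK, h⟩, hpj⟩⟩))
      · exact mem_union_left _ (mem_union_right _ (mem_inter.mpr ⟨hp, mem_biUnion.mpr
          ⟨j, mem_filter.mpr ⟨hjK, h⟩, hpj⟩⟩))
    · exact mem_union_right _ (mem_sdiff.mpr ⟨hp, hpv⟩)
  have hGG : ∀ p ∈ G ∪ G', p.Prime := fun p hp => (mem_union.mp hp).elim (hG p) (hG' p)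
  have h5 : np (A i) ≤ np G * np G' * np V :=
    (np_mono hcov fun p hp => (mem_union.mp hp).elim (hGG p) (hV p)).trans
      ((np_union_le hGG).trans (Nat.mul_le_mul_right _ (np_union_le hG)))
  have h6 : P ≤ (np G : ℝ) * np G' * np V := by
    have : ((np (A i) : ℕ) : ℝ) ≤ (np G : ℝ) * np G' * np V := by exact_mod_cast h5
    linarith [hPi i hi]
  have := max_mul_max_le hP (one_le_np hG) (one_le_np hG') (one_le_np hV) h6
  linarith

end

/-! ### Comparison of prime exponents. -/

theorem np_eq_prod_pow {A B : Finset ℕ} (h : A ⊆ B) :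
    np A = ∏ p ∈ B, p ^ (if p ∈ A then 1 else 0) := by
  rw [np, ← prod_subset h (fun p _ hp => by simp [hp])]
  exact prod_congr rfl fun p hp => by simp [hp]

/-- If each prime of each `S i` occurs in a second `S j`, the primes of the union are controlled. -/
theorem np_biUnion_sq_mul_le {ι : Type*} [Fintype ι] [DecidableEq ι] {S A : ι → Finset ℕ}
    (hS : ∀ i, ∀ p ∈ S i, p.Prime) (hAS : ∀ i, A i ⊆ S i)
    (htwo : ∀ i, ∀ p ∈ S i, ∃ j, j ≠ i ∧ p ∈ S j) (K : Finset ι) :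
    np (univ.biUnion S) ^ 2 * ∏ i ∈ K, np (A i \ (K.erase i).biUnion A) ≤
      np (K.biUnion A) ^ 2 * ∏ i, np (S i \ (if i ∈ K then A i else ∅)) := by
  set T := univ.biUnion S with hT
  have hST : ∀ i, S i ⊆ T := fun i => subset_biUnion_of_mem S (mem_univ i)
  have hTp : ∀ p ∈ T, p.Prime := by
    intro p hp; obtain ⟨j, _, hj⟩ := mem_biUnion.mp hp; exact hS j p hj
  have hUT : K.biUnion A ⊆ T := biUnion_subset.mpr fun i _ => (hAS i).trans (hST i)
  rw [np_eq_prod_pow (Subset.refl T), np_eq_prod_pow hUT,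
    prod_congr rfl fun i _ => np_eq_prod_pow ((sdiff_subset.trans (hAS i)).trans (hST i)),
    prod_congr rfl fun i _ => np_eq_prod_pow (sdiff_subset.trans (hST i)),
    prod_comm (s := K), prod_comm (s := univ), ← prod_pow, ← prod_pow, ← prod_mul_distrib,
    ← prod_mul_distrib]
  -- The inequality is checked prime by prime, on exponents.
  refine prod_le_prod' fun p hp => ?_
  rw [prod_pow_eq_pow_sum, prod_pow_eq_pow_sum, ← pow_mul, ← pow_mul, ← pow_add, ← pow_add]
  refine Nat.pow_le_pow_right (hTp p hp).pos ?_
  rw [if_pos hp, ← card_filter, ← card_filter]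
  -- If p lies in some `A b` with b in K, it is private to at most one `A a`, and then a second set
  -- `S c` still holds p as a leftover. Otherwise p is a leftover in at least two sets.
  obtain ⟨i, _, hi⟩ := mem_biUnion.mp hp
  obtain ⟨j, hji, hj⟩ := htwo i p hi
  by_cases hU : p ∈ K.biUnion A
  · rw [if_pos hU]
    refine Nat.add_le_add_left ?_ _
    rcases (K.filter fun i => p ∈ A i \ (K.erase i).biUnion A).eq_empty_or_nonempty with h | ⟨a, ha⟩
    · rw [h]; simp
    obtain ⟨haK, hpa⟩ := mem_filter.mp ha
    obtain ⟨hpa1, hpa2⟩ := mem_sdiff.mp hpa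
    have honly : ∀ b ∈ K, p ∈ A b → b = a := by
      intro b hb hpb
      by_contra hne
      exact hpa2 (mem_biUnion.mpr ⟨b, mem_erase.mpr ⟨hne, hb⟩, hpb⟩)
    obtain ⟨c, hca, hc⟩ := htwo a p (hAS a hpa1)
    calc _ ≤ 1 := by
          refine card_le_one.mpr fun b hb b' hb' => ?_
          simp only [mem_filter, mem_sdiff] at hb hb'
          rw [honly b hb.1 hb.2.1, honly b' hb'.1 hb'.2.1]
      _ ≤ _ := by
          refine card_pos.mpr ⟨c, mem_filter.mpr ⟨mem_univ _, mem_sdiff.mpr ⟨hc, ?_⟩⟩⟩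
          split_ifs with hcK
          · exact fun h => hca (honly c hcK h)
          · exact notMem_empty _
  · have hno : ∀ b ∈ K, p ∉ A b := fun b hb h => hU (mem_biUnion.mpr ⟨b, hb, h⟩)
    have e : (K.filter fun i => p ∈ A i \ (K.erase i).biUnion A) = ∅ :=
      filter_eq_empty_iff.mpr fun b hb h => hno b hb (mem_sdiff.mp h).1
    have hm : ∀ c, p ∈ S c → c ∈ univ.filter fun i => p ∈ S i \ (if i ∈ K then A i else ∅) := by
      intro c hc
      refine mem_filter.mpr ⟨mem_univ _, mem_sdiff.mpr ⟨hc, ?_⟩⟩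
      split_ifs with hcK
      · exact hno c hcK
      · exact notMem_empty _
    rw [e, if_neg hU]
    have : 2 ≤ #(univ.filter fun i => p ∈ S i \ (if i ∈ K then A i else ∅)) := by
      rw [← card_pair hji]
      refine card_le_card fun c hc => ?_
      rcases mem_insert.mp hc with rfl | hc
      · exact hm _ hj
      · rw [mem_singleton.mp hc]; exact hm _ hi
    simpa using this

/-! ### Decomposition into centred components. -/

/-- The product over `p ∈ S` of the centred indicators of `p ^ k ∣ m`. -/
noncomputable def chi (k : ℕ) (S : Finset ℕ) (m : ℕ) : ℝ :=
  ∏ p ∈ S, (ind (p ^ k) m - ((p : ℝ) ^ k)⁻¹)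

/-- The sum of `chi` over the interval `[n, n + H)`. -/
noncomputable def Psi (k H : ℕ) (S : Finset ℕ) (n : ℕ) : ℝ := ∑ h ∈ range H, chi k S (n + h)

theorem inv_np_pow (A : Finset ℕ) (k : ℕ) : ∏ p ∈ A, ((p : ℝ) ^ k)⁻¹ = ((np A : ℝ) ^ k)⁻¹ := by
  rw [prod_inv_distrib, prod_pow, np]; push_cast; rfl

/-- Each indicator of p^k is its centred version plus p^(-k); after expanding the product, the empty
set gives exactly the main term H/(np A)^k that `psi` subtracts. -/
theorem psi_eq_sum_Psi {A : Finset ℕ} (hA : ∀ p ∈ A, p.Prime) (k H n : ℕ) :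
    psi H (np A ^ k) n =
      ∑ S ∈ A.powerset.erase ∅, Psi k H S n * ((np (A \ S) : ℝ) ^ k)⁻¹ := by
  have h1 : cnt H (np A ^ k) n = ∑ S ∈ A.powerset, Psi k H S n * ((np (A \ S) : ℝ) ^ k)⁻¹ := by
    simp only [Psi, sum_mul, cnt]
    rw [sum_comm]
    refine sum_congr rfl fun h _ => ?_
    rw [ind_np_pow hA, prod_congr rfl fun p _ =>
      (sub_add_cancel (ind (p ^ k) (n + h)) ((p : ℝ) ^ k)⁻¹).symm, prod_add]
    refine sum_congr rfl fun S _ => ?_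
    rw [inv_np_pow, chi]
  rw [← add_sum_erase _ _ (empty_mem_powerset A)] at h1
  rw [psi, h1]
  simp [Psi, chi]
  ring

theorem abs_Psi_le {S : Finset ℕ} (hS : ∀ p ∈ S, p.Prime) (hne : S.Nonempty) (k H n : ℕ) :
    |Psi k H S n| ≤ ∑ t ∈ S.powerset, ((np t : ℝ) ^ k)⁻¹ * |psi H (np (S \ t) ^ k) n| := by
  have h1 : Psi k H S n =
      ∑ t ∈ S.powerset, (-1) ^ #t * ((np t : ℝ) ^ k)⁻¹ * cnt H (np (S \ t) ^ k) n := by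
    simp only [Psi, cnt, mul_sum]
    rw [sum_comm]
    refine sum_congr rfl fun h _ => ?_
    rw [chi, prod_sub]
    refine sum_congr rfl fun t _ => ?_
    rw [inv_np_pow, ind_np_pow fun p hp => hS p (mem_sdiff.mp hp).1]
    ring
  -- The main terms are all H/(np S)^k up to sign and cancel because S is nonempty, so counts may be
  -- replaced by deviations.
  have h2 : ∑ t ∈ S.powerset, (-1 : ℝ) ^ #t * ((np t : ℝ) ^ k)⁻¹ * (H / (np (S \ t) : ℝ) ^ k) = 0 := by
    have e : ∀ t ∈ S.powerset, (-1 : ℝ) ^ #t * ((np t : ℝ) ^ k)⁻¹ * (H / (np (S \ t) : ℝ) ^ k) =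
        ((-1 : ℤ) ^ #t : ℤ) * (H / (np S : ℝ) ^ k) := by
      intro t ht
      have := np_sdiff_mul (mem_powerset.mp ht)
      have h3 : (np S : ℝ) = np (S \ t) * np t := by exact_mod_cast this.symm
      rw [h3, mul_pow]; push_cast
      rw [div_eq_mul_inv, div_eq_mul_inv, mul_inv]; ring
    rw [sum_congr rfl e, ← sum_mul, ← Int.cast_sum,
      sum_powerset_neg_one_pow_card_of_nonempty hne]
    simp
  have h3 : Psi k H S n =
      ∑ t ∈ S.powerset, (-1) ^ #t * ((np t : ℝ) ^ k)⁻¹ * psi H (np (S \ t) ^ k) n := by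
    rw [h1, ← sub_zero (∑ t ∈ S.powerset, _), ← h2, ← sum_sub_distrib]
    refine sum_congr rfl fun t _ => ?_
    unfold psi; push_cast; ring
  rw [h3]
  refine (abs_sum_le_sum_abs _ _).trans (sum_le_sum fun t _ => ?_)
  rw [abs_mul, abs_mul, abs_pow, abs_neg, abs_one, one_pow, one_mul]
  gcongr
  rw [abs_of_nonneg (by positivity)]

/-- Moduli up to P = H^(1/k) use |psi| ≤ 1; larger ones use count plus mean. In both cases what is
not a count is absorbed by min(1, P/np S). -/
theorem abs_Psi_le_sum_min_add {S : Finset ℕ} (hS : ∀ p ∈ S, p.Prime) (hne : S.Nonempty)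
    {k H : ℕ} (hk : k ≠ 0) {P : ℝ} (hP : 1 ≤ P) (hPH : P ^ k = H) (n : ℕ) :
    |Psi k H S n| ≤ ∑ t ∈ S.powerset, ((if P < np (S \ t) then (np t : ℝ)⁻¹ else 0) *
      cnt H (np (S \ t) ^ k) n + min 1 (P / np S)) := by
  refine (abs_Psi_le hS hne k H n).trans (sum_le_sum fun t ht => ?_)
  have htS := mem_powerset.mp ht
  have htp : ∀ p ∈ t, p.Prime := fun p hp => hS p (htS hp)
  have hA : ∀ p ∈ S \ t, p.Prime := fun p hp => hS p (mem_sdiff.mp hp).1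
  have h3 : (np S : ℝ) = np (S \ t) * np t := by exact_mod_cast (np_sdiff_mul htS).symm
  have t1 := one_le_np htp
  have a1 := one_le_np hA
  have s1 := one_le_np hS
  have tk : ((np t : ℝ) ^ k)⁻¹ ≤ (np t : ℝ)⁻¹ := inv_anti₀ (by linarith) (le_self_pow₀ t1 hk)
  have hc0 := cnt_nonneg H (np (S \ t) ^ k) n
  split_ifs with h
  · have h1 := abs_psi_le_cnt_add H (np (S \ t) ^ k) n
    push_cast at h1
    have h2 : ((np t : ℝ) ^ k)⁻¹ * (H / (np (S \ t) : ℝ) ^ k) ≤ min 1 (P / np S) := by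
      have : ((np t : ℝ) ^ k)⁻¹ * (H / (np (S \ t) : ℝ) ^ k) = (P / np S) ^ k := by
        rw [h3, div_pow, hPH, mul_pow, div_eq_mul_inv, div_eq_mul_inv, mul_inv]; ring
      rw [this]
      have hle : P / np S ≤ 1 := by
        rw [div_le_one (by linarith), h3]; nlinarith
      rw [min_eq_right hle]
      exact pow_le_of_le_one (by positivity) hle hk
    calc _ ≤ ((np t : ℝ) ^ k)⁻¹ * (cnt H (np (S \ t) ^ k) n + H / (np (S \ t) : ℝ) ^ k) := by gcongr
      _ = ((np t : ℝ) ^ k)⁻¹ * cnt H (np (S \ t) ^ k) n +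
          ((np t : ℝ) ^ k)⁻¹ * (H / (np (S \ t) : ℝ) ^ k) := by ring
      _ ≤ _ := by gcongr
  · have h1 : |psi H (np (S \ t) ^ k) n| ≤ 1 := abs_psi_le_one (pow_ne_zero _ (np_pos hA).ne') H n
    rw [zero_mul, zero_add]
    have h2 : (np t : ℝ)⁻¹ ≤ min 1 (P / np S) := by
      refine le_min (inv_le_one_of_one_le₀ t1) ?_
      rw [h3, le_div_iff₀ (by positivity)]
      field_simp
      exact not_lt.mp h
    calc _ ≤ ((np t : ℝ) ^ k)⁻¹ * 1 := by gcongr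
      _ ≤ _ := by linarith

/-- Multiplying the three hypotheses cancels U, V and E. -/
theorem mul_mul_le_two_mul_pow {w m T U V E R : ℝ} {a b n : ℕ} (hn : a + b = n) (hR : 0 ≤ R)
    (hU : 0 < U) (hV : 0 ≤ V) (hE : 0 < E) (h1 : w ^ 2 * E ≤ (R ^ 2) ^ b)
    (h2 : m ^ 2 * U ^ 2 ≤ 4 ^ a * (R ^ 2) ^ a * V) (h3 : T ^ 2 * V ≤ U ^ 2 * E) :
    w * m * T ≤ (2 * R) ^ n := by
  have e : ((2 * R) ^ n) ^ 2 = 4 ^ n * (R ^ 2) ^ n := by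
    rw [← pow_mul, mul_comm n 2, pow_mul, mul_pow, mul_pow]; norm_num
  have h4 : (4 : ℝ) ^ a ≤ 4 ^ n := pow_le_pow_right₀ (by norm_num) (by omega)
  have h5 : (w * m * T) ^ 2 * (U ^ 2 * E) ≤ ((2 * R) ^ n) ^ 2 * (U ^ 2 * E) := by
    calc (w * m * T) ^ 2 * (U ^ 2 * E) = ((w ^ 2 * E) * (m ^ 2 * U ^ 2)) * T ^ 2 := by ring
      _ ≤ ((R ^ 2) ^ b * (4 ^ a * (R ^ 2) ^ a * V)) * T ^ 2 := by
          refine mul_le_mul_of_nonneg_right ?_ (sq_nonneg T)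
          exact mul_le_mul h1 h2 (by positivity) (by positivity)
      _ = (4 ^ a * (R ^ 2) ^ n) * (T ^ 2 * V) := by rw [← hn, pow_add]; ring
      _ ≤ (4 ^ n * (R ^ 2) ^ n) * (U ^ 2 * E) := by
          refine mul_le_mul (mul_le_mul_of_nonneg_right h4 (by positivity)) h3 ?_ (by positivity)
          positivity
      _ = _ := by rw [e]
  exact abs_le_of_sq_le_sq' (le_of_mul_le_mul_right h5 (by positivity)) (by positivity) |>.2

/-! ### Means of products of deviations. -/

section
variable {ι : Type*} [Fintype ι] [LinearOrder ι]

/-- Indices in K carry counts, the others carry min(1, R²/np S_i), whose square is at most R²/np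
S_i. The squared weights thus supply the leftover product E, which the exponent comparison trades
for the primes of the whole union. -/
theorem weighted_mean_prod_cnt_le {S t : ι → Finset ℕ} (hS : ∀ i, ∀ p ∈ S i, p.Prime)
    (ht : ∀ i, t i ⊆ S i) (htwo : ∀ i, ∀ p ∈ S i, ∃ j, j ≠ i ∧ p ∈ S j)
    {k H Q : ℕ} (hk : k ≠ 0) {R : ℝ} (hR : 1 ≤ R) (hRH : (R ^ 2) ^ k = H) (hQ : Q ≠ 0)
    (hd : np (univ.biUnion S) ^ k ∣ Q) (K : Finset ι) (hK : ∀ i ∈ K, R ^ 2 < np (S i \ t i)) :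
    ((∏ i ∈ K, (np (t i) : ℝ)⁻¹) * ∏ i ∈ univ \ K, min 1 (R ^ 2 / np (S i))) *
      mean Q (fun n => ∏ i ∈ K, cnt H (np (S i \ t i) ^ k) n) ≤
    (2 * R) ^ Fintype.card ι / np (univ.biUnion S) := by
  have hP : 1 ≤ R ^ 2 := one_le_pow₀ hR
  set A : ι → Finset ℕ := fun i => S i \ t i with hAdef
  have hAS : ∀ i, A i ⊆ S i := fun i => sdiff_subset
  have hA : ∀ i, ∀ p ∈ A i, p.Prime := fun i p hp => hS i p (hAS i hp)
  have hUT : K.biUnion A ⊆ univ.biUnion S := biUnion_subset.mpr fun i _ =>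
    (hAS i).trans (subset_biUnion_of_mem S (mem_univ i))
  have hTp : ∀ p ∈ univ.biUnion S, p.Prime := by
    intro p hp; obtain ⟨j, _, hj⟩ := mem_biUnion.mp hp; exact hS j p hj
  have hUp : ∀ p ∈ K.biUnion A, p.Prime := fun p hp => hTp p (hUT hp)
  have hsq := sq_mean_prod_cnt_le hA hk hP hRH hQ K hK
    ((pow_dvd_pow_of_dvd (np_dvd hUT) k).trans hd)
  have hcomb := np_biUnion_sq_mul_le hS hAS htwo K
  have t1 : ∀ i, (1 : ℝ) ≤ np (t i) := fun i => one_le_np fun p hp => hS i p (ht i hp)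
  have s1 : ∀ i, (1 : ℝ) ≤ np (S i) := fun i => one_le_np (hS i)
  have T1 := one_le_np hTp
  have U1 := one_le_np hUp
  set T : ℝ := ((np (univ.biUnion S) : ℕ) : ℝ)
  set U : ℝ := ((np (K.biUnion A) : ℕ) : ℝ)
  set m := mean Q (fun n => ∏ i ∈ K, cnt H (np (A i) ^ k) n)
  set w := (∏ i ∈ K, (np (t i) : ℝ)⁻¹) * ∏ i ∈ univ \ K, min 1 (R ^ 2 / np (S i)) with hw
  set V : ℝ := ∏ i ∈ K, (np (A i \ (K.erase i).biUnion A) : ℝ) with hV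
  set E : ℝ := ∏ i, (np (S i \ (if i ∈ K then A i else ∅)) : ℝ) with hE
  have hcombR : T ^ 2 * V ≤ U ^ 2 * E := by
    simp only [T, U, hV, hE]; exact_mod_cast hcomb
  have hE1 : E = (∏ i ∈ K, (np (t i) : ℝ)) * ∏ i ∈ univ \ K, (np (S i) : ℝ) := by
    rw [hE, ← prod_sdiff (subset_univ K), mul_comm]
    congr 1
    · refine prod_congr rfl fun i hi => ?_
      rw [if_pos hi, hAdef]
      simp only [sdiff_sdiff_right_self]
      congr 2
      exact inf_eq_right.mpr (ht i)
    · refine prod_congr rfl fun i hi => ?_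
      rw [if_neg (mem_sdiff.mp hi).2, sdiff_empty]
  have hE0 : 0 < E := by
    rw [hE1]
    exact mul_pos (prod_pos fun i _ => by linarith [t1 i]) (prod_pos fun i _ => by linarith [s1 i])
  have hw2 : w ^ 2 * E ≤ (R ^ 2) ^ #(univ \ K) := by
    rw [hw, hE1, mul_pow, mul_mul_mul_comm, ← prod_pow, ← prod_pow, ← prod_mul_distrib,
      ← prod_mul_distrib, ← prod_const]
    refine (mul_le_of_le_one_left ?_ ?_).trans (prod_le_prod ?_ ?_)
    · exact prod_nonneg fun i _ => by positivity
    · refine prod_le_one (fun i _ => by positivity) fun i _ => ?_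
      have := t1 i
      rw [sq, mul_assoc, inv_mul_cancel₀ (by positivity), mul_one]
      exact inv_le_one_of_one_le₀ this
    · intro i _; positivity
    · intro i _
      have := s1 i
      have h1 : min 1 (R ^ 2 / (np (S i) : ℝ)) ^ 2 ≤ R ^ 2 / np (S i) := by
        have ha : min 1 (R ^ 2 / (np (S i) : ℝ)) ≤ 1 := min_le_left _ _
        have hb : min 1 (R ^ 2 / (np (S i) : ℝ)) ≤ R ^ 2 / np (S i) := min_le_right _ _
        have hc : 0 ≤ min 1 (R ^ 2 / (np (S i) : ℝ)) := by positivity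
        nlinarith
      calc _ ≤ R ^ 2 / np (S i) * np (S i) := by gcongr
        _ = _ := by field_simp
  have hw0 : 0 ≤ w := by positivity
  have hV0 : 0 ≤ V := by positivity
  have hm0 : 0 ≤ m := mean_nonneg fun n => prod_nonneg fun i _ => cnt_nonneg _ _ _
  have hsq' : m ^ 2 * U ^ 2 ≤ 4 ^ #K * (R ^ 2) ^ #K * V := by
    rw [le_div_iff₀ (by positivity), prod_mul_distrib, prod_const, mul_pow] at hsq
    exact hsq
  have hcard : #K + #(univ \ K) = Fintype.card ι := by
    rw [add_comm, card_sdiff_add_card_eq_card (subset_univ K), card_univ]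
  rw [le_div_iff₀ (by positivity)]
  exact mul_mul_le_two_mul_pow hcard (by linarith) (by linarith) hV0 hE0 hw2 hsq' hcombR

theorem mean_prod_abs_Psi_le {S : ι → Finset ℕ} (hS : ∀ i, ∀ p ∈ S i, p.Prime)
    (hne : ∀ i, (S i).Nonempty) (htwo : ∀ i, ∀ p ∈ S i, ∃ j, j ≠ i ∧ p ∈ S j)
    {k H Q : ℕ} (hk : k ≠ 0) {R : ℝ} (hR : 1 ≤ R) (hRH : (R ^ 2) ^ k = H) (hQ : Q ≠ 0)
    (hd : np (univ.biUnion S) ^ k ∣ Q) :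
    mean Q (fun n => ∏ i, |Psi k H (S i) n|) ≤
      (∏ i, (2 : ℝ) ^ #(S i)) * ((4 * R) ^ Fintype.card ι / np (univ.biUnion S)) := by
  have hP : 1 ≤ R ^ 2 := one_le_pow₀ hR
  set w : ι → Finset ℕ → ℝ := fun i t => if R ^ 2 < np (S i \ t) then (np t : ℝ)⁻¹ else 0 with hw
  have h1 : ∀ n, ∏ i, |Psi k H (S i) n| ≤
      ∑ t ∈ Fintype.piFinset (fun i => (S i).powerset), ∑ K ∈ (univ : Finset ι).powerset,
        ((∏ i ∈ K, w i (t i)) * ∏ i ∈ univ \ K, min 1 (R ^ 2 / np (S i))) *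
          ∏ i ∈ K, cnt H (np (S i \ t i) ^ k) n := by
    intro n
    refine (prod_le_prod (fun _ _ => abs_nonneg _) fun i _ =>
      abs_Psi_le_sum_min_add (hS i) (hne i) hk hP hRH n).trans_eq ?_
    rw [prod_univ_sum]
    refine sum_congr rfl fun t _ => ?_
    rw [prod_add]
    refine sum_congr rfl fun K _ => ?_
    rw [prod_mul_distrib]; ring
  refine (mean_mono h1).trans ?_
  rw [mean_sum]
  simp only [mean_sum, mean_const_mul]
  have hTp : ∀ p ∈ univ.biUnion S, p.Prime := by
    intro p hp; obtain ⟨j, _, hj⟩ := mem_biUnion.mp hp; exact hS j p hj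
  have hb : 0 ≤ (2 * R) ^ Fintype.card ι / (np (univ.biUnion S) : ℝ) := by positivity
  calc _ ≤ ∑ t ∈ Fintype.piFinset (fun i => (S i).powerset), ∑ K ∈ (univ : Finset ι).powerset,
          (2 * R) ^ Fintype.card ι / (np (univ.biUnion S) : ℝ) := by
        refine sum_le_sum fun t ht => sum_le_sum fun K _ => ?_
        have htS : ∀ i, t i ⊆ S i := fun i => mem_powerset.mp (Fintype.mem_piFinset.mp ht i)
        by_cases hK : ∀ i ∈ K, R ^ 2 < np (S i \ t i)
        · have e : ∏ i ∈ K, w i (t i) = ∏ i ∈ K, (np (t i) : ℝ)⁻¹ :=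
            prod_congr rfl fun i hi => if_pos (hK i hi)
          rw [e]
          exact weighted_mean_prod_cnt_le hS htS htwo hk hR hRH hQ hd K hK
        · push Not at hK
          obtain ⟨i, hi, hlt⟩ := hK
          have e : ∏ i ∈ K, w i (t i) = 0 := prod_eq_zero hi (if_neg (not_lt.mpr hlt))
          rw [e, zero_mul, zero_mul]; exact hb
    _ = _ := by
        simp only [sum_const, Fintype.card_piFinset, card_powerset, nsmul_eq_mul, card_univ]
        push_cast
        rw [show (4 * R) = 2 * (2 * R) by ring, mul_pow 2 (2 * R)]; ring

/-- The centred indicator at p has mean zero and is independent of all other factors, which involve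
only other primes. -/
theorem mean_prod_Psi_eq_zero {S : ι → Finset ℕ} (hS : ∀ i, ∀ p ∈ S i, p.Prime)
    {i : ι} {p : ℕ} (hp : p ∈ S i) (h : ∀ j, j ≠ i → p ∉ S j) {k H Q : ℕ} (hQ : Q ≠ 0)
    (hd : np (univ.biUnion S) ^ k ∣ Q) :
    mean Q (fun n => ∏ i, Psi k H (S i) n) = 0 := by
  simp only [Psi, prod_univ_sum]
  rw [mean_sum]
  refine sum_eq_zero fun b _ => ?_
  set f : ℕ → ℝ := fun n => chi k ((S i).erase p) (n + b i) *
    ∏ j ∈ univ.erase i, chi k (S j) (n + b j) with hf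
  set B := (univ.biUnion S).erase p with hB
  have hTp : ∀ p ∈ univ.biUnion S, p.Prime := by
    intro p hp; obtain ⟨j, _, hj⟩ := mem_biUnion.mp hp; exact hS j p hj
  have hpp := hS i p hp
  have hchi : ∀ S' ⊆ B, ∀ c, Function.Periodic (fun n => chi k S' (n + c)) (np B ^ k) := by
    intro S' hS' c n
    refine prod_congr rfl fun q hq => ?_
    have := periodic_ind (c := q ^ k) (M := np B ^ k)
      (pow_dvd_pow_of_dvd (dvd_prod_of_mem _ (hS' hq)) k) c n
    simp only at this
    rw [this]
  have hfp : Function.Periodic f (np B ^ k) := by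
    refine (hchi _ (erase_subset_erase p (subset_biUnion_of_mem S (mem_univ i))) _).mul ?_
    intro n
    refine prod_congr rfl fun j hj => hchi _ ?_ _ n
    intro q hq
    exact mem_erase.mpr ⟨fun e => h j (ne_of_mem_erase hj) (e ▸ hq),
      mem_biUnion.mpr ⟨j, mem_univ _, hq⟩⟩
  have hco : (np B ^ k).Coprime (p ^ k) := by
    refine Nat.Coprime.pow k k ?_
    have := np_coprime (A := B) (B := {p}) (fun q hq => hTp q (mem_of_mem_erase hq))
      (by simpa using hpp) (by simp [hB])
    simpa [np] using this
  have hdvd : np B ^ k * p ^ k ∣ Q := by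
    rw [← mul_pow]
    have : np B * p = np (univ.biUnion S) :=
      prod_erase_mul _ _ (mem_biUnion.mpr ⟨i, mem_univ _, hp⟩)
    rwa [this]
  have e : ∀ n, ∏ j, chi k (S j) (n + b j) =
      f n * ind (p ^ k) (n + b i) + (-((p : ℝ) ^ k)⁻¹) * f n := by
    intro n
    rw [← mul_prod_erase univ _ (mem_univ i), chi, ← mul_prod_erase (S i) _ hp, hf]
    simp only [chi]; ring
  have hadd : mean Q (fun n => f n * ind (p ^ k) (n + b i) + (-((p : ℝ) ^ k)⁻¹) * f n) =
      mean Q (fun n => f n * ind (p ^ k) (n + b i)) + mean Q (fun n => (-((p : ℝ) ^ k)⁻¹) * f n) := by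
    simp only [mean, sum_add_distrib, add_div]
  rw [funext e, hadd, mean_mul_ind hfp hco hQ hdvd, mean_const_mul]
  push_cast
  ring

theorem abs_mean_prod_psi_le {A : ι → Finset ℕ} (hA : ∀ i, ∀ p ∈ A i, p.Prime)
    {k H Q : ℕ} (hk : k ≠ 0) {R : ℝ} (hR : 1 ≤ R) (hRH : (R ^ 2) ^ k = H) (hQ : Q ≠ 0)
    (hd : np (univ.biUnion A) ^ k ∣ Q) :
    |mean Q (fun n => ∏ i, psi H (np (A i) ^ k) n)| ≤
      (∏ i, (4 : ℝ) ^ #(A i)) * ((4 * R) ^ Fintype.card ι / np (univ.biUnion A)) := by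
  have hTp : ∀ p ∈ univ.biUnion A, p.Prime := by
    intro p hp; obtain ⟨j, _, hj⟩ := mem_biUnion.mp hp; exact hA j p hj
  have T1 := one_le_np hTp
  have e : ∀ n, ∏ i, psi H (np (A i) ^ k) n =
      ∑ S ∈ Fintype.piFinset (fun i => (A i).powerset.erase ∅),
        (∏ i, ((np (A i \ S i) : ℝ) ^ k)⁻¹) * ∏ i, Psi k H (S i) n := by
    intro n
    rw [prod_congr rfl fun i _ => psi_eq_sum_Psi (hA i) k H n, prod_univ_sum]
    refine sum_congr rfl fun S _ => ?_
    rw [prod_mul_distrib, mul_comm]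
  rw [funext e, mean_sum]
  simp only [mean_const_mul]
  refine (abs_sum_le_sum_abs _ _).trans ?_
  have hmain : ∀ S ∈ Fintype.piFinset (fun i => (A i).powerset.erase ∅),
      |(∏ i, ((np (A i \ S i) : ℝ) ^ k)⁻¹) * mean Q (fun n => ∏ i, Psi k H (S i) n)| ≤
        (∏ i, (2 : ℝ) ^ #(A i)) * ((4 * R) ^ Fintype.card ι / np (univ.biUnion A)) := by
    intro S hS
    have hS' : ∀ i, (S i).Nonempty ∧ S i ⊆ A i := by
      intro i
      have := mem_erase.mp (Fintype.mem_piFinset.mp hS i)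
      exact ⟨nonempty_iff_ne_empty.mpr this.1, mem_powerset.mp this.2⟩
    have hSp : ∀ i, ∀ p ∈ S i, p.Prime := fun i p hp => hA i p ((hS' i).2 hp)
    have hdS : np (univ.biUnion S) ^ k ∣ Q :=
      (pow_dvd_pow_of_dvd (np_dvd (biUnion_mono fun i _ => (hS' i).2)) k).trans hd
    by_cases htwo : ∀ i, ∀ p ∈ S i, ∃ j, j ≠ i ∧ p ∈ S j
    · have h1 := mean_prod_abs_Psi_le hSp (fun i => (hS' i).1) htwo hk hR hRH hQ hdS
      have h2 : |mean Q (fun n => ∏ i, Psi k H (S i) n)| ≤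
          mean Q (fun n => ∏ i, |Psi k H (S i) n|) := by
        simpa only [abs_prod] using abs_mean_le Q (fun n => ∏ i, Psi k H (S i) n)
      have hSTp : ∀ p ∈ univ.biUnion S, p.Prime := by
        intro p hp; obtain ⟨j, _, hj⟩ := mem_biUnion.mp hp; exact hSp j p hj
      have hdp : ∀ i, ∀ p ∈ A i \ S i, p.Prime := fun i p hp => hA i p (mem_sdiff.mp hp).1
      -- Primes lost in passing from A to S occur in some `A i \ S i`, whose weights restore the
      -- missing factors 1/p.
      have hcov : univ.biUnion A ⊆ univ.biUnion S ∪ univ.biUnion (fun i => A i \ S i) := by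
        intro p hp
        obtain ⟨i, _, hi⟩ := mem_biUnion.mp hp
        by_cases hpS : p ∈ S i
        · exact mem_union_left _ (mem_biUnion.mpr ⟨i, mem_univ _, hpS⟩)
        · exact mem_union_right _ (mem_biUnion.mpr ⟨i, mem_univ _, mem_sdiff.mpr ⟨hi, hpS⟩⟩)
      have hprod : ∀ J : Finset ι, np (J.biUnion fun i => A i \ S i) ≤ ∏ i ∈ J, np (A i \ S i) := by
        intro J
        induction J using Finset.induction_on with
        | empty => simp [np]
        | insert a s ha ih =>
          rw [biUnion_insert, prod_insert ha]
          exact (np_union_le (hdp a)).trans (Nat.mul_le_mul_left _ ih)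
      have hT : (np (univ.biUnion A) : ℝ) ≤ np (univ.biUnion S) * ∏ i, (np (A i \ S i) : ℝ) := by
        have h3 : np (univ.biUnion A) ≤ np (univ.biUnion S) * ∏ i, np (A i \ S i) :=
          (np_mono hcov fun p hp => (mem_union.mp hp).elim (hSTp p) fun h => by
            obtain ⟨j, _, hj⟩ := mem_biUnion.mp h; exact hdp j p hj).trans
            ((np_union_le hSTp).trans (Nat.mul_le_mul_left _ (hprod univ)))
        exact_mod_cast h3
      have hD1 : ∀ i, (1 : ℝ) ≤ np (A i \ S i) := fun i => one_le_np (hdp i)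
      have hk1 : ∏ i, ((np (A i \ S i) : ℝ) ^ k)⁻¹ ≤ (∏ i, (np (A i \ S i) : ℝ))⁻¹ := by
        rw [← prod_inv_distrib]
        refine prod_le_prod (fun i _ => by positivity) fun i _ =>
          inv_anti₀ (by linarith [hD1 i]) (le_self_pow₀ (hD1 i) hk)
      have hD0 : 0 < ∏ i, (np (A i \ S i) : ℝ) := prod_pos fun i _ => by linarith [hD1 i]
      have hST1 := one_le_np hSTp
      rw [abs_mul, abs_of_nonneg (prod_nonneg fun i _ => by positivity)]
      calc _ ≤ (∏ i, (np (A i \ S i) : ℝ))⁻¹ *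
            ((∏ i, (2 : ℝ) ^ #(S i)) * ((4 * R) ^ Fintype.card ι / np (univ.biUnion S))) :=
            mul_le_mul hk1 (h2.trans h1) (abs_nonneg _) (by positivity)
        _ = (∏ i, (2 : ℝ) ^ #(S i)) * ((4 * R) ^ Fintype.card ι /
              (np (univ.biUnion S) * ∏ i, (np (A i \ S i) : ℝ))) := by
            rw [div_eq_mul_inv, div_eq_mul_inv, mul_inv]; ring
        _ ≤ _ := by
            gcongr with i
            · norm_num
            · exact (hS' i).2
    · push Not at htwo
      obtain ⟨i, p, hp, h⟩ := htwo
      rw [mean_prod_Psi_eq_zero hSp hp h hQ hdS, mul_zero, abs_zero]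
      positivity
  refine (sum_le_card_nsmul _ _ _ hmain).trans ?_
  rw [nsmul_eq_mul, Fintype.card_piFinset, ← mul_assoc]
  gcongr
  push_cast
  rw [← prod_mul_distrib]
  refine prod_le_prod (fun i _ => by positivity) fun i _ => ?_
  have h4 : (#((A i).powerset.erase ∅) : ℝ) ≤ 2 ^ #(A i) := by
    have := card_le_card (erase_subset ∅ (A i).powerset)
    rw [card_powerset] at this
    exact_mod_cast this
  calc _ ≤ (2 : ℝ) ^ #(A i) * 2 ^ #(A i) := by gcongr
    _ = _ := by rw [← mul_pow]; norm_num

end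

end KFree

namespace KFree
open Finset ArithmeticFunction

/-! ### Möbius inversion and truncation of the discrepancy. -/

/-- Let a be the product of the primes p with p^k ∣ m. A squarefree d satisfies d^k ∣ m exactly when
d ∣ a, and a ≤ B, so the sum is that of μ over the divisors of a. -/
theorem moebius_eq (k : ℕ) (hk : k ≠ 0) {m B : ℕ} (hm : 0 < m) (hB : m < (B + 1) ^ k) :
    mu k m = ∑ d ∈ Icc 1 B, (moebius d : ℝ) * ind (d ^ k) m := by
  set R := m.primeFactors.filter fun p => p ^ k ∣ m with hR
  have hRp : ∀ p ∈ R, p.Prime := fun p hp => Nat.prime_of_mem_primeFactors (mem_filter.mp hp).1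
  set a := np R with ha
  have ham : a ^ k ∣ m := by
    have h1 := ind_np_pow hRp k m
    rw [prod_eq_one fun p hp => by simp [ind, (mem_filter.mp hp).2]] at h1
    by_contra h
    simp [ind, ← ha, h] at h1
  have ha0 : a ≠ 0 := (np_pos hRp).ne'
  have haB : a ≤ B := by
    have h1 : a ^ k < (B + 1) ^ k := (Nat.le_of_dvd hm ham).trans_lt hB
    have := lt_of_pow_lt_pow_left₀ k (by omega) h1
    omega
  have hda : ∀ d, Squarefree d → d ^ k ∣ m → d ∣ a := by
    intro d hd h
    rw [← Nat.prod_primeFactors_of_squarefree hd]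
    refine np_dvd fun p hp => ?_
    have hpp := Nat.prime_of_mem_primeFactors hp
    have hpk : p ^ k ∣ m := (pow_dvd_pow_of_dvd (Nat.dvd_of_mem_primeFactors hp) k).trans h
    exact mem_filter.mpr ⟨Nat.mem_primeFactors.mpr
      ⟨hpp, (dvd_pow_self p hk).trans hpk, hm.ne'⟩, hpk⟩
  have h1 : ∑ d ∈ Icc 1 B, (moebius d : ℝ) * ind (d ^ k) m = ∑ d ∈ a.divisors, (moebius d : ℝ) := by
    symm
    have hsub : a.divisors ⊆ Icc 1 B := by
      intro d hd
      have h := Nat.dvd_of_mem_divisors hd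
      exact mem_Icc.mpr ⟨Nat.pos_of_dvd_of_pos h (Nat.pos_of_ne_zero ha0),
        (Nat.le_of_dvd (Nat.pos_of_ne_zero ha0) h).trans haB⟩
    rw [← sum_subset hsub (f := fun d => (moebius d : ℝ) * ind (d ^ k) m)]
    · refine sum_congr rfl fun d hd => ?_
      have := (pow_dvd_pow_of_dvd (Nat.dvd_of_mem_divisors hd) k).trans ham
      simp [ind, this]
    · intro d _ hd
      by_cases hsq : Squarefree d
      · have : ¬ d ^ k ∣ m := fun h => hd (Nat.mem_divisors.mpr ⟨hda d hsq h, ha0⟩)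
        simp [ind, this]
      · simp [moebius_eq_zero_of_not_squarefree hsq]
  have h2 : ∑ d ∈ a.divisors, (moebius d : ℝ) = if a = 1 then 1 else 0 := by
    have := congrArg (fun f : ArithmeticFunction ℤ => f a) coe_zeta_mul_moebius
    simp only [coe_zeta_mul_apply, one_apply] at this
    exact_mod_cast this
  have h3 : IsKFree k m ↔ a = 1 := by
    constructor
    · intro h
      by_contra hne
      exact h.2 a (by omega) ham
    · intro h
      refine ⟨hm, fun d hd hdm => ?_⟩
      obtain ⟨p, hp, hpd⟩ := Nat.exists_prime_and_dvd hd.ne'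
      have := hda p hp.prime.squarefree ((pow_dvd_pow_of_dvd hpd k).trans hdm)
      rw [h] at this
      exact hp.one_lt.ne' (Nat.dvd_one.mp this)
  rw [h1, h2, mu]
  simp [Set.indicator, h3]

theorem hasSum_moebius_inv_zeta {k : ℕ} (hk : 2 ≤ k) :
    HasSum (fun d : ℕ => (moebius d : ℝ) * ((d : ℝ) ^ k)⁻¹) (riemannZeta (k : ℂ)).re⁻¹ := by
  have hk1 : 1 < (k : ℂ).re := by simp; omega
  have hs : Summable (fun d : ℕ => (moebius d : ℝ) * ((d : ℝ) ^ k)⁻¹) := by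
    refine Summable.of_norm_bounded (g := fun d : ℕ => ((d : ℝ) ^ k)⁻¹)
      (Real.summable_nat_pow_inv.mpr (by omega)) fun d => ?_
    rw [norm_mul, Real.norm_eq_abs, Real.norm_eq_abs, abs_of_nonneg (a := ((d : ℝ) ^ k)⁻¹) (by positivity)]
    have : |(moebius d : ℝ)| ≤ 1 := by exact_mod_cast abs_moebius_le_one
    exact mul_le_of_le_one_left (by positivity) this
  have hz : riemannZeta (k : ℂ) = ((∑' n : ℕ, 1 / (n : ℝ) ^ k : ℝ) : ℂ) := by
    rw [zeta_nat_eq_tsum_of_gt_one (by omega)]; push_cast; rfl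
  have hL : LSeries (fun n => (moebius n : ℂ)) k =
      ((∑' d : ℕ, (moebius d : ℝ) * ((d : ℝ) ^ k)⁻¹ : ℝ) : ℂ) := by
    rw [LSeries]; push_cast
    refine tsum_congr fun n => ?_
    rcases eq_or_ne n 0 with rfl | hn
    · simp
    · rw [LSeries.term_of_ne_zero hn]; simp [div_eq_mul_inv]
  have hmul := LSeries_zeta_mul_Lseries_moebius hk1
  rw [LSeries_zeta_eq_riemannZeta hk1, hL, hz, ← Complex.ofReal_mul] at hmul
  have hmul' : (∑' n : ℕ, 1 / (n : ℝ) ^ k) * (∑' d : ℕ, (moebius d : ℝ) * ((d : ℝ) ^ k)⁻¹) = 1 := by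
    exact_mod_cast hmul
  rw [hz, Complex.ofReal_re, ← eq_inv_of_mul_eq_one_right hmul']
  exact hs.hasSum

theorem abs_moebius_cast_le (d : ℕ) : |(moebius d : ℝ)| ≤ 1 := by
  exact_mod_cast abs_moebius_le_one

theorem abs_inv_zeta_sub_le {k : ℕ} (hk : 2 ≤ k) {B : ℕ} (hB : 1 ≤ B) :
    |(riemannZeta (k : ℂ)).re⁻¹ - ∑ d ∈ Icc 1 B, (moebius d : ℝ) * ((d : ℝ) ^ k)⁻¹| ≤
      ((B : ℝ) ^ (k - 1))⁻¹ := by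
  set f := fun d : ℕ => (moebius d : ℝ) * ((d : ℝ) ^ k)⁻¹ with hf
  have h1 := (hasSum_moebius_inv_zeta hk).tendsto_sum_nat
  have h2 := ((h1.comp (Filter.tendsto_add_atTop_nat 1)).sub_const (∑ d ∈ Icc 1 B, f d)).abs
  refine le_of_tendsto h2 (Filter.eventually_atTop.mpr ⟨B, fun M hM => ?_⟩)
  have e : ∑ d ∈ range (M + 1), f d - ∑ d ∈ Icc 1 B, f d = ∑ d ∈ Ioc B M, f d := by
    -- The index 0 contributes nothing, since μ(0) = 0.
    have e1 : range (M + 1) = insert 0 (Icc 1 B ∪ Ioc B M) := by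
      ext x; simp; omega
    rw [e1, sum_insert (by simp), sum_union]
    · simp [hf]
    · rw [disjoint_left]; intro x; simp; omega
  simp only [Function.comp_apply]
  rw [e]
  refine (abs_sum_le_sum_abs _ _).trans ((sum_le_sum fun d _ => ?_).trans (sum_Ioc_inv_pow_le hk hB M))
  rw [hf, abs_mul, abs_of_nonneg (a := ((d : ℝ) ^ k)⁻¹) (by positivity)]
  exact mul_le_of_le_one_left (by positivity) (abs_moebius_cast_le d)

theorem abs_inv_zeta_le {k : ℕ} (hk : 2 ≤ k) : |(riemannZeta (k : ℂ)).re⁻¹| ≤ 2 := by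
  have := abs_inv_zeta_sub_le hk le_rfl
  simp only [Icc_self, sum_singleton, Nat.cast_one, one_pow, inv_one, mul_one, moebius_apply_one,
    Int.cast_one] at this
  rw [abs_le] at this ⊢
  constructor <;> linarith

/-- The discrepancy with the Möbius sum truncated at `B`. -/
noncomputable def truncD (k B H n : ℕ) : ℝ := ∑ d ∈ Icc 1 B, (moebius d : ℝ) * psi H (d ^ k) n

theorem abs_D_sub_truncD_le {k : ℕ} (hk : 2 ≤ k) {B H n : ℕ} (hB : 1 ≤ B) (hn : 0 < n)
    (hnB : n + H ≤ (B + 1) ^ k) : |D k n H - truncD k B H n| ≤ H / (B : ℝ) ^ (k - 1) := by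
  have h1 : N k n H = ∑ d ∈ Icc 1 B, (moebius d : ℝ) * cnt H (d ^ k) n := by
    simp only [N, cnt, mul_sum]
    rw [sum_comm]
    refine sum_congr rfl fun h hh => ?_
    have := mem_range.mp hh
    exact moebius_eq k (by omega) (by omega) (by omega)
  have h2 : truncD k B H n = N k n H - (∑ d ∈ Icc 1 B, (moebius d : ℝ) * ((d : ℝ) ^ k)⁻¹) * H := by
    rw [h1, sum_mul, ← sum_sub_distrib]
    refine sum_congr rfl fun d _ => ?_
    unfold psi; push_cast; ring
  have h3 := abs_inv_zeta_sub_le hk hB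
  have e : D k n H - truncD k B H n = -(((riemannZeta (k : ℂ)).re⁻¹ -
      ∑ d ∈ Icc 1 B, (moebius d : ℝ) * ((d : ℝ) ^ k)⁻¹) * H) := by
    rw [h2, D]; ring
  rw [e, abs_neg, abs_mul, Nat.abs_cast, div_eq_inv_mul]
  gcongr

theorem abs_D_le {k : ℕ} (hk : 2 ≤ k) (n H : ℕ) : |D k n H| ≤ 3 * H := by
  have h1 : |N k n H| ≤ H := by
    refine (abs_sum_le_sum_abs _ _).trans ((sum_le_card_nsmul _ _ 1 fun h _ => ?_).trans_eq (by simp))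
    by_cases hm : IsKFree k (n + h) <;> simp [mu, Set.indicator, hm]
  have h2 := abs_inv_zeta_le hk
  have h3 : |(riemannZeta (k : ℂ)).re⁻¹ * (H : ℝ)| ≤ 2 * H := by
    rw [abs_mul, Nat.abs_cast]; gcongr
  unfold D
  exact (abs_sub _ _).trans (by linarith)

theorem abs_truncD_le {k : ℕ} (B H n : ℕ) : |truncD k B H n| ≤ B := by
  refine (abs_sum_le_sum_abs _ _).trans ((sum_le_card_nsmul _ _ 1 fun d hd => ?_).trans_eq (by simp))
  rw [abs_mul]
  have h1 := abs_psi_le_one (c := d ^ k) (pow_ne_zero _ (by have := (mem_Icc.mp hd).1; omega)) H n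
  have h2 := abs_moebius_cast_le d
  exact mul_le_one₀ h2 (abs_nonneg _) h1

/-! ### Tuples with small least common multiple. -/

/-- The squarefree numbers up to `B`. -/
def sqf (B : ℕ) : Finset ℕ := (Icc 1 B).filter Squarefree

theorem mem_sqf {B d : ℕ} : d ∈ sqf B ↔ (1 ≤ d ∧ d ≤ B) ∧ Squarefree d := by
  simp [sqf]

/-- The least common multiple of the entries of a tuple of squarefree numbers. -/
def radT {ι : Type*} [Fintype ι] (d : ι → ℕ) : ℕ := np (univ.biUnion fun i => (d i).primeFactors)

theorem np_primeFactors {d : ℕ} (hd : Squarefree d) : np d.primeFactors = d :=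
  Nat.prod_primeFactors_of_squarefree hd

theorem primeFactors_np {A : Finset ℕ} (hA : ∀ p ∈ A, p.Prime) : (np A).primeFactors = A :=
  Nat.primeFactors_prod hA

theorem np_pow_dvd {A : Finset ℕ} (hA : ∀ p ∈ A, p.Prime) {k m : ℕ} (h : ∀ p ∈ A, p ^ k ∣ m) :
    np A ^ k ∣ m := by
  have h1 := ind_np_pow hA k m
  rw [prod_eq_one fun p hp => by simp [ind, h p hp]] at h1
  by_contra h'
  simp [ind, h'] at h1

theorem card_filter_primeFactors_subset_le (B : ℕ) (R : Finset ℕ) :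
    #((sqf B).filter fun d => d.primeFactors ⊆ R) ≤ 2 ^ #R := by
  rw [← card_powerset]
  refine card_le_card_of_injOn Nat.primeFactors (fun d hd => ?_) fun d hd e he h => ?_
  · exact mem_coe.mpr (mem_powerset.mpr (mem_filter.mp (mem_coe.mp hd)).2)
  · have h1 := (mem_sqf.mp (mem_filter.mp (mem_coe.mp hd)).1).2
    have h2 := (mem_sqf.mp (mem_filter.mp (mem_coe.mp he)).1).2
    rw [← np_primeFactors h1, ← np_primeFactors h2, h]

theorem mean_shift {f : ℕ → ℝ} {Q : ℕ} (hf : Function.Periodic f Q) :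
    mean Q (fun n => f (n + 1)) = mean Q f := by
  have h := (sum_range_succ' f Q).symm.trans (sum_range_succ f Q)
  have h0 : f Q = f 0 := by simpa using hf 0
  unfold mean
  congr 1
  linarith

theorem sum_Ioc_eq_sum_range (f : ℕ → ℝ) (X : ℕ) :
    ∑ n ∈ Ioc 0 X, f n = ∑ n ∈ range X, f (n + 1) := by
  rw [← Ico_add_one_add_one_eq_Ioc, sum_Ico_eq_sum_range]
  simp [add_comm]

section
variable {ι : Type*} [Fintype ι] [DecidableEq ι]

/-- Summing over tuples of squarefree numbers according to a common multiple `τ d`. -/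
theorem sum_tuples_le {B : ℕ} {s : Finset (ι → ℕ)} (τ : (ι → ℕ) → ℕ)
    (hs : ∀ d ∈ s, ∀ i, d i ∈ sqf B)
    (hsub : ∀ d ∈ s, ∀ i, (d i).primeFactors ⊆ (τ d).primeFactors)
    (hτ : ∀ d ∈ s, τ d ∈ Icc 1 B) {g : ℕ → ℝ} (hg : ∀ T ∈ Icc 1 B, 0 ≤ g T) {V : ℝ}
    (hV : ∀ T ∈ Icc 1 B, (2 : ℝ) ^ #T.primeFactors ≤ V) :
    ∑ d ∈ s, g (τ d) ≤ V ^ Fintype.card ι * ∑ T ∈ Icc 1 B, g T := by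
  rw [← sum_fiberwise_of_maps_to hτ, mul_sum]
  refine sum_le_sum fun T hT => ?_
  have hcard : (#(s.filter fun d => τ d = T) : ℝ) ≤ V ^ Fintype.card ι := by
    have h1 : s.filter (fun d => τ d = T) ⊆
        Fintype.piFinset fun _ : ι => (sqf B).filter fun d => d.primeFactors ⊆ T.primeFactors := by
      intro d hd
      obtain ⟨hds, hdT⟩ := mem_filter.mp hd
      exact Fintype.mem_piFinset.mpr fun i => mem_filter.mpr ⟨hs d hds i, hdT ▸ hsub d hds i⟩
    have h2 := card_le_card h1
    rw [Fintype.card_piFinset, prod_const, card_univ] at h2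
    have h3 := h2.trans (Nat.pow_le_pow_left
      (card_filter_primeFactors_subset_le B T.primeFactors) _)
    calc (#(s.filter fun d => τ d = T) : ℝ) ≤ ((2 : ℝ) ^ #T.primeFactors) ^ Fintype.card ι := by
          exact_mod_cast h3
      _ ≤ _ := by gcongr; exact hV T hT
  calc _ = ∑ d ∈ s.filter (fun d => τ d = T), g T :=
        sum_congr rfl fun d hd => by rw [(mem_filter.mp hd).2]
    _ = #(s.filter fun d => τ d = T) * g T := by rw [sum_const, nsmul_eq_mul]
    _ ≤ _ := mul_le_mul_of_nonneg_right hcard (hg T hT)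

/-- Expanding each factor into indicators and their means gives H^ℓ tuples of shifts and 2^ℓ
subsets, each a system of congruences counted with error at most 1. -/
theorem abs_sum_prod_psi_sub_le {A : ι → Finset ℕ} (hA : ∀ i, ∀ p ∈ A i, p.Prime)
    (k H X : ℕ) :
    |∑ n ∈ Ioc 0 X, ∏ i, psi H (np (A i) ^ k) n -
      X * mean (np (univ.biUnion A) ^ k) (fun n => ∏ i, psi H (np (A i) ^ k) n)| ≤
      (2 * H : ℝ) ^ Fintype.card ι := by
  set Q := np (univ.biUnion A) ^ k with hQdef
  have hTp : ∀ p ∈ univ.biUnion A, p.Prime := by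
    intro p hp; obtain ⟨j, _, hj⟩ := mem_biUnion.mp hp; exact hA j p hj
  have hQ : Q ≠ 0 := pow_ne_zero _ (np_pos hTp).ne'
  have hcQ : ∀ i, np (A i) ^ k ∣ Q := fun i =>
    pow_dvd_pow_of_dvd (np_dvd (subset_biUnion_of_mem A (mem_univ i))) k
  have hper : Function.Periodic (fun n => ∏ i, psi H (np (A i) ^ k) n) Q := by
    intro n
    refine prod_congr rfl fun i _ => ?_
    unfold psi
    rw [periodic_cnt (hcQ i) H n]
  rw [sum_Ioc_eq_sum_range, ← mean_shift hper]
  set g : (ι → ℕ) → Finset ι → ℕ → ℝ := fun h K n => ∏ i ∈ K, ind (np (A i) ^ k) (n + (1 + h i))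
  set w : Finset ι → ℝ := fun K => ∏ i ∈ univ \ K, (-((np (A i) : ℝ) ^ k)⁻¹)
  have hexp : ∀ n, ∏ i, psi H (np (A i) ^ k) (n + 1) =
      ∑ h ∈ Fintype.piFinset (fun _ : ι => range H), ∑ K ∈ (univ : Finset ι).powerset,
        w K * g h K n := by
    intro n
    have h1 : ∀ i, psi H (np (A i) ^ k) (n + 1) = ∑ h ∈ range H,
        (ind (np (A i) ^ k) (n + (1 + h)) + (-((np (A i) : ℝ) ^ k)⁻¹)) := by
      intro i
      rw [sum_add_distrib, sum_const, card_range, nsmul_eq_mul, psi, cnt]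
      simp only [add_assoc]
      push_cast; ring
    simp only [h1]
    rw [prod_univ_sum]
    refine sum_congr rfl fun h _ => ?_
    rw [prod_add]
    exact sum_congr rfl fun K _ => mul_comm _ _
  simp only [hexp]
  rw [mean_sum]
  simp only [mean_sum, mean_const_mul]
  rw [sum_comm, mul_sum, ← sum_sub_distrib]
  have hw : ∀ K, |w K| ≤ 1 := by
    intro K
    rw [abs_prod]
    refine prod_le_one (fun _ _ => abs_nonneg _) fun i _ => ?_
    rw [abs_neg, abs_of_nonneg (by positivity)]
    exact inv_le_one_of_one_le₀ (one_le_pow₀ (one_le_np (hA i)))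
  have hterm : ∀ h K, |∑ n ∈ range X, w K * g h K n - X * (w K * mean Q (g h K))| ≤ 1 := by
    intro h K
    have e : ∑ n ∈ range X, w K * g h K n - X * (w K * mean Q (g h K)) =
        w K * (∑ n ∈ range X, g h K n - X * mean Q (g h K)) := by rw [← mul_sum]; ring
    rw [e, abs_mul]
    refine mul_le_one₀ (hw K) (abs_nonneg _) ?_
    have hUp : ∀ p ∈ K.biUnion A, p.Prime := by
      intro p hp; obtain ⟨j, _, hj⟩ := mem_biUnion.mp hp; exact hA j p hj
    have hcM : ∀ i ∈ K, np (A i) ^ k ∣ np (K.biUnion A) ^ k := fun i hi =>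
      pow_dvd_pow_of_dvd (np_dvd (subset_biUnion_of_mem A hi)) k
    have hpM : Function.Periodic (g h K) (np (K.biUnion A) ^ k) := by
      intro n
      exact prod_congr rfl fun i hi => periodic_ind (hcM i hi) _ n
    have hMQ : np (K.biUnion A) ^ k ∣ Q :=
      pow_dvd_pow_of_dvd (np_dvd (biUnion_subset_biUnion_of_subset_left A (subset_univ K))) k
    rw [mean_eq_of_dvd hpM hMQ hQ]
    refine abs_sum_prod_ind_sub_le K _ _ (pow_ne_zero _ (np_pos hUp).ne') hcM (fun z hz => ?_) X
    rw [Int.natCast_dvd]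
    refine np_pow_dvd hUp fun p hp => ?_
    obtain ⟨i, hi, hpi⟩ := mem_biUnion.mp hp
    exact (pow_dvd_pow_of_dvd (dvd_prod_of_mem _ hpi) k).trans (Int.natCast_dvd.mp (hz i hi))
  calc _ ≤ ∑ h ∈ Fintype.piFinset (fun _ : ι => range H), ∑ K ∈ (univ : Finset ι).powerset,
        (1 : ℝ) := by
        refine (abs_sum_le_sum_abs _ _).trans (sum_le_sum fun h _ => ?_)
        rw [sum_comm, mul_sum, ← sum_sub_distrib]
        exact (abs_sum_le_sum_abs _ _).trans (sum_le_sum fun K _ => hterm h K)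
    _ = _ := by
        simp only [sum_const, Fintype.card_piFinset, card_powerset, nsmul_eq_mul, card_univ,
          prod_const, card_range, mul_one]
        push_cast
        rw [mul_pow]; ring

end

section
variable {ι : Type*} [Fintype ι] [LinearOrder ι]

theorem sum_abs_small_le {k H B X : ℕ} (hk : k ≠ 0) {R V : ℝ} (hR : 1 ≤ R)
    (hRH : (R ^ 2) ^ k = H) (hV1 : 1 ≤ V)
    (hV : ∀ T ∈ Icc 1 B, (2 : ℝ) ^ #T.primeFactors ≤ V)
    (hLV : ∑ T ∈ Icc 1 B, (T : ℝ)⁻¹ ≤ V) :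
    ∑ d ∈ (Fintype.piFinset fun _ : ι => sqf B).filter (fun d => radT d ≤ B),
      |∑ n ∈ Ioc 0 X, ∏ i, psi H (d i ^ k) n| ≤
      4 ^ Fintype.card ι * V ^ (3 * Fintype.card ι + 1) *
        (X * R ^ Fintype.card ι + (H : ℝ) ^ Fintype.card ι * B) := by
  set ℓ := Fintype.card ι
  -- V^(2ℓ) dominates the divisor factors ∏ 4^ω(d_i), so the bound depends on the tuple only through
  -- T.
  set g : ℕ → ℝ := fun T => X * (V ^ (2 * ℓ) * ((4 * R) ^ ℓ * (T : ℝ)⁻¹)) + (2 * H : ℝ) ^ ℓ with hg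
  have hmem : ∀ d ∈ (Fintype.piFinset fun _ : ι => sqf B).filter (fun d => radT d ≤ B),
      (∀ i, d i ∈ sqf B) ∧ radT d ∈ Icc 1 B ∧
      (radT d).primeFactors = univ.biUnion fun i => (d i).primeFactors := by
    intro d hd
    obtain ⟨h1, h2⟩ := mem_filter.mp hd
    have hTp : ∀ p ∈ univ.biUnion fun i => (d i).primeFactors, p.Prime := by
      intro p hp; obtain ⟨j, _, hj⟩ := mem_biUnion.mp hp
      exact Nat.prime_of_mem_primeFactors hj
    exact ⟨Fintype.mem_piFinset.mp h1, mem_Icc.mpr ⟨np_pos hTp, h2⟩, primeFactors_np hTp⟩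
  have h1 : ∀ d ∈ (Fintype.piFinset fun _ : ι => sqf B).filter (fun d => radT d ≤ B),
      |∑ n ∈ Ioc 0 X, ∏ i, psi H (d i ^ k) n| ≤ g (radT d) := by
    intro d hd
    obtain ⟨hd1, hd2, hd3⟩ := hmem d hd
    have hA : ∀ i, ∀ p ∈ (d i).primeFactors, p.Prime := fun i p hp =>
      Nat.prime_of_mem_primeFactors hp
    have hnp : ∀ i, np (d i).primeFactors = d i := fun i => np_primeFactors (mem_sqf.mp (hd1 i)).2
    have hTp : ∀ p ∈ univ.biUnion fun i => (d i).primeFactors, p.Prime := by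
      intro p hp; obtain ⟨j, _, hj⟩ := mem_biUnion.mp hp
      exact Nat.prime_of_mem_primeFactors hj
    have h2 := abs_sum_prod_psi_sub_le hA k H X
    have h3 := abs_mean_prod_psi_le hA hk hR hRH (pow_ne_zero k (np_pos hTp).ne') dvd_rfl
    simp only [hnp] at h2 h3
    have h4 : ∏ i, (4 : ℝ) ^ #(d i).primeFactors ≤ V ^ (2 * ℓ) := by
      calc _ ≤ ∏ _i : ι, V ^ 2 := by
            refine prod_le_prod (fun _ _ => by positivity) fun i _ => ?_
            have e : (4 : ℝ) ^ #(d i).primeFactors = ((2 : ℝ) ^ #(d i).primeFactors) ^ 2 := by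
              rw [← pow_mul, mul_comm, pow_mul]; norm_num
            rw [e]
            gcongr
            exact hV _ (mem_Icc.mpr (mem_sqf.mp (hd1 i)).1)
        _ = _ := by rw [prod_const, card_univ, ← pow_mul]
    have h5 := h3.trans (mul_le_mul_of_nonneg_right h4 (by positivity))
    rw [hg]
    change _ ≤ (X : ℝ) * (V ^ (2 * ℓ) * ((4 * R) ^ ℓ * ((np (univ.biUnion
      fun i => (d i).primeFactors) : ℕ) : ℝ)⁻¹)) + (2 * H : ℝ) ^ ℓ
    rw [← div_eq_mul_inv]
    calc _ ≤ |(X : ℝ) * mean (np (univ.biUnion fun i => (d i).primeFactors) ^ k)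
          (fun n => ∏ i, psi H (d i ^ k) n)| + (2 * H : ℝ) ^ ℓ := by
          have := abs_sub_abs_le_abs_sub (∑ n ∈ Ioc 0 X, ∏ i, psi H (d i ^ k) n)
            ((X : ℝ) * mean (np (univ.biUnion fun i => (d i).primeFactors) ^ k)
              (fun n => ∏ i, psi H (d i ^ k) n))
          linarith
      _ ≤ _ := by
          rw [abs_mul, Nat.abs_cast]
          gcongr
  refine (sum_le_sum h1).trans ((sum_tuples_le radT (fun d hd => (hmem d hd).1) (fun d hd i => ?_)
    (fun d hd => (hmem d hd).2.1) (fun T _ => by positivity) hV).trans ?_)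
  · rw [(hmem d hd).2.2]
    exact subset_biUnion_of_mem (fun i => (d i).primeFactors) (mem_univ i)
  · have e : ∑ T ∈ Icc 1 B, g T =
        X * (V ^ (2 * ℓ) * ((4 * R) ^ ℓ * ∑ T ∈ Icc 1 B, (T : ℝ)⁻¹)) + B * (2 * H : ℝ) ^ ℓ := by
      simp only [hg, sum_add_distrib, ← mul_sum, sum_const, Nat.card_Icc, nsmul_eq_mul]
      simp
    rw [e]
    have h2ℓ : (2 : ℝ) ^ ℓ ≤ 4 ^ ℓ := by gcongr; norm_num
    calc V ^ ℓ * (X * (V ^ (2 * ℓ) * ((4 * R) ^ ℓ * ∑ T ∈ Icc 1 B, (T : ℝ)⁻¹)) + B * (2 * H : ℝ) ^ ℓ)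
        ≤ V ^ ℓ * (X * (V ^ (2 * ℓ) * ((4 * R) ^ ℓ * V)) +
            V ^ (2 * ℓ + 1) * (B * (4 ^ ℓ * (H : ℝ) ^ ℓ))) := by
          have h6 : 1 ≤ V ^ (2 * ℓ + 1) := one_le_pow₀ hV1
          have h7 : (B : ℝ) * (2 * H : ℝ) ^ ℓ ≤ V ^ (2 * ℓ + 1) * (B * (4 ^ ℓ * (H : ℝ) ^ ℓ)) := by
            rw [mul_pow]
            refine le_trans ?_ (le_mul_of_one_le_left (by positivity) h6)
            gcongr
          gcongr
      _ = _ := by rw [mul_pow]; ring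

end

/-! ### Tuples with large least common multiple. -/

/-- Either a single factor already reaches y, or the product passes y by a factor below y and so
stays below y² ≤ B. -/
theorem exists_subset_prod_between {ι : Type*} [DecidableEq ι] {t : ι → ℕ} {J : Finset ι} {B : ℕ}
    {y : ℝ} (hy : 1 ≤ y) (hyB : y ^ 2 ≤ B) (ht : ∀ i ∈ J, t i ≤ B)
    (hJ : y ≤ ((∏ i ∈ J, t i : ℕ) : ℝ)) :
    ∃ I ⊆ J, y ≤ ((∏ i ∈ I, t i : ℕ) : ℝ) ∧ ∏ i ∈ I, t i ≤ B := by
  induction J using Finset.induction_on with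
  | empty =>
    refine ⟨∅, Subset.refl _, hJ, ?_⟩
    have : (1 : ℝ) ≤ B := by nlinarith
    simpa using (by exact_mod_cast this : 1 ≤ B)
  | insert a s ha ih =>
    by_cases hs : y ≤ ((∏ i ∈ s, t i : ℕ) : ℝ)
    · obtain ⟨I, hI, h⟩ := ih (fun i hi => ht i (mem_insert_of_mem hi)) hs
      exact ⟨I, hI.trans (subset_insert _ _), h⟩
    by_cases hta : y ≤ t a
    · exact ⟨{a}, by simp, by simpa using hta, by simpa using ht a (mem_insert_self _ _)⟩
    · refine ⟨insert a s, Subset.refl _, hJ, ?_⟩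
      rw [prod_insert ha]
      push Not at hs hta
      have : ((t a * ∏ i ∈ s, t i : ℕ) : ℝ) ≤ B := by
        rw [Nat.cast_mul]
        calc _ ≤ y * y := by gcongr
          _ ≤ _ := by rw [← sq]; exact hyB
      exact_mod_cast this

/-- The indicator of `d ^ k ∣ m` plus its mean. -/
noncomputable def wt (k d m : ℕ) : ℝ := ind (d ^ k) m + ((d : ℝ) ^ k)⁻¹

theorem wt_nonneg (k d m : ℕ) : 0 ≤ wt k d m := add_nonneg (ind_nonneg _ _) (by positivity)

theorem abs_psi_le_sum_wt (k H d n : ℕ) : |psi H (d ^ k) n| ≤ ∑ h ∈ range H, wt k d (n + h) := by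
  refine (abs_psi_le_cnt_add H (d ^ k) n).trans_eq ?_
  simp only [wt, sum_add_distrib, cnt, sum_const, card_range, nsmul_eq_mul]
  push_cast; rw [div_eq_mul_inv]

/-- At most 2^ω(m) squarefree d have d^k ∣ m, and the reciprocals d^(-k) over multiples of q sum to
at most 2 q^(-k). -/
theorem sum_filter_dvd_wt_le {k : ℕ} (hk : 2 ≤ k) {B m q : ℕ} (hm : m ≠ 0) (hq : q ∈ sqf B)
    {V : ℝ} (hV : (2 : ℝ) ^ #m.primeFactors ≤ V) :
    ∑ d ∈ (sqf B).filter (q ∣ ·), wt k d m ≤ (V + 2) * wt k q m := by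
  have hq1 := (mem_sqf.mp hq).1.1
  have hV0 : 0 ≤ V := le_trans (by positivity) hV
  have h1 : ∑ d ∈ (sqf B).filter (q ∣ ·), ind (d ^ k) m ≤ V * ind (q ^ k) m := by
    by_cases hqm : q ^ k ∣ m
    · have e : ind (q ^ k) m = 1 := by simp [ind, hqm]
      rw [e, mul_one]
      simp only [ind]
      rw [← sum_filter, sum_const, nsmul_eq_mul, mul_one]
      refine le_trans ?_ hV
      have hsub : ((sqf B).filter (q ∣ ·)).filter (fun d => d ^ k ∣ m) ⊆
          (sqf B).filter fun d => d.primeFactors ⊆ m.primeFactors := by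
        intro d hd
        obtain ⟨hd1, hd2⟩ := mem_filter.mp hd
        refine mem_filter.mpr ⟨(mem_filter.mp hd1).1, ?_⟩
        exact Nat.primeFactors_mono ((dvd_pow_self d (by omega)).trans hd2) hm
      exact_mod_cast (card_le_card hsub).trans (card_filter_primeFactors_subset_le B _)
    · have e : ind (q ^ k) m = 0 := by simp [ind, hqm]
      rw [e, mul_zero]
      refine (sum_eq_zero fun d hd => ?_).le
      have : ¬ d ^ k ∣ m := fun h => hqm ((pow_dvd_pow_of_dvd (mem_filter.mp hd).2 k).trans h)
      simp [ind, this]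
  have h2 : ∑ d ∈ (sqf B).filter (q ∣ ·), ((d : ℝ) ^ k)⁻¹ ≤ 2 * ((q : ℝ) ^ k)⁻¹ := by
    have hsub : (sqf B).filter (q ∣ ·) ⊆ (Icc 1 B).image (q * ·) := by
      intro d hd
      obtain ⟨hd1, j, rfl⟩ := mem_filter.mp hd
      have h := (mem_sqf.mp hd1).1
      refine mem_image.mpr ⟨j, mem_Icc.mpr ⟨?_, ?_⟩, rfl⟩
      · rcases Nat.eq_zero_or_pos j with rfl | h'
        · simp at h
        · exact h'
      · exact (Nat.le_mul_of_pos_left j hq1).trans h.2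
    calc _ ≤ ∑ d ∈ (Icc 1 B).image (q * ·), ((d : ℝ) ^ k)⁻¹ :=
          sum_le_sum_of_subset_of_nonneg hsub fun _ _ _ => by positivity
      _ = ∑ j ∈ Icc 1 B, (((q * j : ℕ) : ℝ) ^ k)⁻¹ :=
          sum_image fun a _ b _ h => Nat.eq_of_mul_eq_mul_left hq1 h
      _ = ((q : ℝ) ^ k)⁻¹ * ∑ j ∈ Icc 1 B, ((j : ℝ) ^ k)⁻¹ := by
          rw [mul_sum]
          refine sum_congr rfl fun j _ => ?_
          push_cast; rw [mul_pow, mul_inv]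
      _ ≤ ((q : ℝ) ^ k)⁻¹ * 2 := by gcongr; exact sum_Icc_inv_pow_le hk B
      _ = _ := mul_comm _ _
  simp only [wt, sum_add_distrib]
  have h3 := ind_nonneg (q ^ k) m
  have h4 : (0 : ℝ) ≤ ((q : ℝ) ^ k)⁻¹ := by positivity
  nlinarith

section
variable {ι : Type*} [Fintype ι] [DecidableEq ι]

theorem sum_prod_wt_le {q : ι → ℕ} (hq : ∀ i, q i ≠ 0)
    (hco : Pairwise fun i j => (q i).Coprime (q j)) (k X : ℕ) (b : ι → ℕ) :
    ∑ n ∈ Ioc 0 X, ∏ i, wt k (q i) (n + b i) ≤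
      2 ^ Fintype.card ι * (X / ((∏ i, q i : ℕ) : ℝ) ^ k + 1) := by
  rw [sum_Ioc_eq_sum_range]
  have h1 : ∀ n, ∏ i, wt k (q i) (n + 1 + b i) = ∑ K ∈ (univ : Finset ι).powerset,
      (∏ i ∈ univ \ K, ((q i : ℝ) ^ k)⁻¹) * ∏ i ∈ K, ind (q i ^ k) (n + (1 + b i)) := by
    intro n
    simp only [wt]
    rw [prod_add]
    refine sum_congr rfl fun K _ => ?_
    simp only [add_assoc]
    exact mul_comm _ _
  simp only [h1]
  rw [sum_comm]
  have hq1 : ∀ i, (1 : ℝ) ≤ q i := fun i => by exact_mod_cast Nat.pos_of_ne_zero (hq i)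
  refine (sum_le_card_nsmul _ _ ((X : ℝ) / ((∏ i, q i : ℕ) : ℝ) ^ k + 1) fun K _ => ?_).trans_eq ?_
  · rw [← mul_sum]
    have hc : ∀ i ∈ K, q i ^ k ∣ (∏ i ∈ K, q i) ^ k := fun i hi =>
      pow_dvd_pow_of_dvd (dvd_prod_of_mem q hi) k
    have hz : ∀ z : ℤ, (∀ i ∈ K, ((q i ^ k : ℕ) : ℤ) ∣ z) → (((∏ i ∈ K, q i) ^ k : ℕ) : ℤ) ∣ z := by
      intro z hz
      rw [Int.natCast_dvd, ← prod_pow]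
      refine prod_dvd_of_isRelPrime (fun i _ j _ hij => ?_) fun i hi => Int.natCast_dvd.mp (hz i hi)
      exact Nat.coprime_iff_isRelPrime.mp (Nat.Coprime.pow k k (hco hij))
    have h2 := sum_prod_ind_le K (fun i => q i ^ k) (fun i => 1 + b i)
      (pow_ne_zero k (prod_ne_zero_iff.mpr fun i _ => hq i)) hc hz X
    have hw1 : ∏ i ∈ univ \ K, ((q i : ℝ) ^ k)⁻¹ ≤ 1 :=
      prod_le_one (fun _ _ => by positivity) fun i _ => inv_le_one_of_one_le₀ (one_le_pow₀ (hq1 i))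
    have hw0 : 0 ≤ ∏ i ∈ univ \ K, ((q i : ℝ) ^ k)⁻¹ := prod_nonneg fun _ _ => by positivity
    calc _ ≤ (∏ i ∈ univ \ K, ((q i : ℝ) ^ k)⁻¹) * (X / (((∏ i ∈ K, q i) ^ k : ℕ) : ℝ) + 1) := by
          gcongr
      _ = X / ((∏ i, q i : ℕ) : ℝ) ^ k + ∏ i ∈ univ \ K, ((q i : ℝ) ^ k)⁻¹ := by
          rw [mul_add, mul_one, ← prod_sdiff (subset_univ K)]
          push_cast
          rw [prod_inv_distrib, prod_pow, mul_pow, div_eq_mul_inv, div_eq_mul_inv, mul_inv]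
          ring
      _ ≤ _ := by gcongr
  · rw [card_powerset, card_univ, nsmul_eq_mul]; push_cast; rfl

/-- Tuples of pairwise coprime squarefree numbers whose product lies in `[y, B]`. -/
noncomputable def coprimeTuples (ι : Type*) [Fintype ι] [DecidableEq ι] (y : ℝ) (B : ℕ) :
    Finset (ι → ℕ) :=
  open scoped Classical in
  (Fintype.piFinset fun _ : ι => sqf B).filter fun q =>
    (Pairwise fun i j => (q i).Coprime (q j)) ∧ y ≤ ((∏ i, q i : ℕ) : ℝ) ∧ ∏ i, q i ≤ B

theorem mem_coprimeTuples {y : ℝ} {B : ℕ} {q : ι → ℕ} :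
    q ∈ coprimeTuples ι y B ↔ (∀ i, q i ∈ sqf B) ∧
      (Pairwise fun i j => (q i).Coprime (q j)) ∧ y ≤ ((∏ i, q i : ℕ) : ℝ) ∧ ∏ i, q i ≤ B := by
  simp [coprimeTuples, Fintype.mem_piFinset]

/-- For a product T ≥ y one has X/T^k ≤ (X/y^(k-1))/T, which leaves a harmonic sum over T ≤ B. -/
theorem sum_coprimeTuples_le {k : ℕ} (hk : k ≠ 0) {B X : ℕ} {y V : ℝ} (hy : 1 ≤ y) (hV1 : 1 ≤ V)
    (hV : ∀ T ∈ Icc 1 B, (2 : ℝ) ^ #T.primeFactors ≤ V)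
    (hLV : ∑ T ∈ Icc 1 B, (T : ℝ)⁻¹ ≤ V) :
    ∑ q ∈ coprimeTuples ι y B, ((X : ℝ) / ((∏ i, q i : ℕ) : ℝ) ^ k + 1) ≤
      V ^ (Fintype.card ι + 1) * (X / y ^ (k - 1) + B) := by
  have h1 : ∀ q ∈ coprimeTuples ι y B, (X : ℝ) / ((∏ i, q i : ℕ) : ℝ) ^ k + 1 ≤
      (fun T : ℕ => X / y ^ (k - 1) * (T : ℝ)⁻¹ + 1) (∏ i, q i) := by
    intro q hq
    have hqy := (mem_coprimeTuples.mp hq).2.2.1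
    have e : ((∏ i, q i : ℕ) : ℝ) ^ k =
        ((∏ i, q i : ℕ) : ℝ) ^ (k - 1) * ((∏ i, q i : ℕ) : ℝ) := by
      rw [← pow_succ]; congr 1; omega
    simp only
    rw [e, ← div_eq_mul_inv, ← div_div]
    gcongr
  refine (sum_le_sum h1).trans ((sum_tuples_le (fun q => ∏ i, q i) (B := B)
    (g := fun T : ℕ => X / y ^ (k - 1) * (T : ℝ)⁻¹ + 1)
    (fun q hq => (mem_coprimeTuples.mp hq).1) (fun q hq i => ?_) (fun q hq => ?_)
    (fun T _ => by positivity) hV).trans ?_)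
  · refine Nat.primeFactors_mono (dvd_prod_of_mem q (mem_univ i)) ?_
    refine prod_ne_zero_iff.mpr fun j _ => ?_
    have := (mem_sqf.mp ((mem_coprimeTuples.mp hq).1 j)).1.1
    omega
  · refine mem_Icc.mpr ⟨Nat.succ_le_of_lt (prod_pos fun j _ => ?_), (mem_coprimeTuples.mp hq).2.2.2⟩
    exact (mem_sqf.mp ((mem_coprimeTuples.mp hq).1 j)).1.1
  · simp only [sum_add_distrib, ← mul_sum, sum_const, Nat.card_Icc, nsmul_eq_mul, mul_one,
      Nat.add_sub_cancel]
    rw [pow_succ, mul_assoc]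
    have h0 : (0 : ℝ) ≤ X / y ^ (k - 1) := by positivity
    have hB0 : (0 : ℝ) ≤ B := by positivity
    refine mul_le_mul_of_nonneg_left ?_ (by positivity)
    nlinarith [mul_le_mul_of_nonneg_left hLV h0]

end

section
variable {ι : Type*} [Fintype ι] [LinearOrder ι]

/-- Giving each prime to the first entry it divides yields pairwise coprime divisors with product
`radT d`; a subset of them has product in [y, B], and the remaining entries are set to 1. -/
theorem exists_coprimeTuple_dvd {y : ℝ} {B : ℕ} (hy : 1 ≤ y) (hyB : y ^ 2 ≤ B) {d : ι → ℕ}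
    (hd : ∀ i, d i ∈ sqf B) (hT : B < radT d) : ∃ q ∈ coprimeTuples ι y B, ∀ i, q i ∣ d i := by
  set A : ι → Finset ℕ := fun i => (d i).primeFactors with hAdef
  have hA : ∀ i, ∀ p ∈ A i, p.Prime := fun i p hp => Nat.prime_of_mem_primeFactors hp
  set t : ι → Finset ℕ := fun i => A i \ (univ.filter (· < i)).biUnion A with ht
  have htA : ∀ i, t i ⊆ A i := fun i => sdiff_subset
  have htp : ∀ i, ∀ p ∈ t i, p.Prime := fun i p hp => hA i p (htA i hp)
  have hlt : ∀ i j, i < j → Disjoint (t i) (t j) := by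
    intro i j hij
    rw [disjoint_left]
    intro p hpi hpj
    exact (mem_sdiff.mp hpj).2 (mem_biUnion.mpr ⟨i, mem_filter.mpr ⟨mem_univ _, hij⟩, htA i hpi⟩)
  have hdisj : Pairwise fun i j => Disjoint (t i) (t j) := by
    intro i j hij
    rcases lt_or_gt_of_ne hij with h | h
    · exact hlt i j h
    · exact (hlt j i h).symm
  have hun : univ.biUnion t = univ.biUnion A := by
    refine Subset.antisymm (biUnion_mono fun i _ => htA i) fun p hp => ?_
    obtain ⟨i, _, hi⟩ := mem_biUnion.mp hp
    obtain ⟨m, hm, hmin⟩ := exists_min_image (univ.filter fun j => p ∈ A j) id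
      ⟨i, mem_filter.mpr ⟨mem_univ _, hi⟩⟩
    refine mem_biUnion.mpr ⟨m, mem_univ _, mem_sdiff.mpr ⟨(mem_filter.mp hm).2, fun h => ?_⟩⟩
    obtain ⟨j, hj, hpj⟩ := mem_biUnion.mp h
    exact absurd (hmin j (mem_filter.mpr ⟨mem_univ _, hpj⟩)) (not_le.mpr (mem_filter.mp hj).2)
  have hprod : ∏ i, np (t i) = radT d := by
    rw [radT, ← hun, np, prod_biUnion fun i _ j _ hij => hdisj hij]
    rfl
  have htd : ∀ i, np (t i) ∣ d i := fun i =>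
    (np_dvd (htA i)).trans (dvd_of_eq (np_primeFactors (mem_sqf.mp (hd i)).2))
  have htB : ∀ i ∈ (univ : Finset ι), np (t i) ≤ B := fun i _ =>
    (Nat.le_of_dvd (mem_sqf.mp (hd i)).1.1 (htd i)).trans (mem_sqf.mp (hd i)).1.2
  have hJ : y ≤ ((∏ i, np (t i) : ℕ) : ℝ) := by
    rw [hprod]
    have : (B : ℝ) ≤ radT d := by exact_mod_cast hT.le
    nlinarith
  obtain ⟨I, -, hI1, hI2⟩ := exists_subset_prod_between hy hyB htB hJ
  have hqprod : ∏ i, (if i ∈ I then np (t i) else 1) = ∏ i ∈ I, np (t i) := by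
    rw [prod_ite_mem, univ_inter]
  have hB1 : 1 ≤ B := by
    have : (1 : ℝ) ≤ B := by nlinarith
    exact_mod_cast this
  refine ⟨fun i => if i ∈ I then np (t i) else 1, mem_coprimeTuples.mpr ⟨fun i => ?_,
    fun i j hij => ?_, by rwa [hqprod], by rwa [hqprod]⟩, fun i => ?_⟩
  · split_ifs
    · exact mem_sqf.mpr ⟨⟨np_pos (htp i), htB i (mem_univ i)⟩,
        (mem_sqf.mp (hd i)).2.squarefree_of_dvd (htd i)⟩
    · exact mem_sqf.mpr ⟨⟨le_rfl, hB1⟩, squarefree_one⟩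
  · simp only
    split_ifs
    · exact np_coprime (htp i) (htp j) (hdisj hij)
    all_goals simp
  · simp only
    split_ifs
    · exact htd i
    · exact one_dvd _

theorem sum_prod_wt_large_le {k : ℕ} (hk : 2 ≤ k) {B : ℕ} {y V : ℝ} (hy : 1 ≤ y)
    (hyB : y ^ 2 ≤ B) (m : ι → ℕ) (hm : ∀ i, m i ≠ 0)
    (hV : ∀ i, (2 : ℝ) ^ #(m i).primeFactors ≤ V) :
    ∑ d ∈ (Fintype.piFinset fun _ : ι => sqf B).filter (fun d => ¬ radT d ≤ B),
      ∏ i, wt k (d i) (m i) ≤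
      (V + 2) ^ Fintype.card ι * ∑ q ∈ coprimeTuples ι y B, ∏ i, wt k (q i) (m i) := by
  have hw : ∀ d : ι → ℕ, 0 ≤ ∏ i, wt k (d i) (m i) := fun d => prod_nonneg fun i _ => wt_nonneg _ _ _
  calc ∑ d ∈ (Fintype.piFinset fun _ : ι => sqf B).filter (fun d => ¬ radT d ≤ B),
        ∏ i, wt k (d i) (m i)
      ≤ ∑ d ∈ (Fintype.piFinset fun _ : ι => sqf B).filter (fun d => ¬ radT d ≤ B),
          ∑ q ∈ coprimeTuples ι y B,
            if ∀ i, q i ∣ d i then ∏ i, wt k (d i) (m i) else 0 := by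
        refine sum_le_sum fun d hd => ?_
        obtain ⟨hd1, hd2⟩ := mem_filter.mp hd
        obtain ⟨q, hq, hqd⟩ := exists_coprimeTuple_dvd hy hyB (Fintype.mem_piFinset.mp hd1)
          (not_le.mp hd2)
        refine le_trans (if_pos hqd).ge (single_le_sum (f := fun q : ι → ℕ =>
          if ∀ i, q i ∣ d i then ∏ i, wt k (d i) (m i) else 0) (fun q _ => ?_) hq)
        split_ifs
        · exact hw d
        · exact le_rfl
    _ ≤ ∑ d ∈ Fintype.piFinset fun _ : ι => sqf B, ∑ q ∈ coprimeTuples ι y B,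
            if ∀ i, q i ∣ d i then ∏ i, wt k (d i) (m i) else 0 := by
        refine sum_le_sum_of_subset_of_nonneg (filter_subset _ _) fun d _ _ =>
          sum_nonneg fun q _ => ?_
        split_ifs
        · exact hw d
        · exact le_rfl
    _ = ∑ q ∈ coprimeTuples ι y B, ∏ i, ∑ d ∈ (sqf B).filter (q i ∣ ·), wt k d (m i) := by
        rw [sum_comm]
        refine sum_congr rfl fun q _ => ?_
        rw [prod_univ_sum, ← sum_filter]
        refine sum_congr ?_ fun _ _ => rfl
        ext d
        simp only [mem_filter, Fintype.mem_piFinset]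
        exact forall_and.symm
    _ ≤ ∑ q ∈ coprimeTuples ι y B, ∏ i, ((V + 2) * wt k (q i) (m i)) := by
        refine sum_le_sum fun q hq => prod_le_prod (fun i _ => sum_nonneg fun d _ => wt_nonneg _ _ _)
          fun i _ => ?_
        exact sum_filter_dvd_wt_le hk (hm i) ((mem_coprimeTuples.mp hq).1 i) (hV i)
    _ = _ := by
        rw [mul_sum]
        refine sum_congr rfl fun q _ => ?_
        rw [prod_mul_distrib, prod_const, card_univ]

theorem sum_abs_large_le {k : ℕ} (hk : 2 ≤ k) {B X H : ℕ} {y V : ℝ} (hy : 1 ≤ y)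
    (hyB : y ^ 2 ≤ B) (hV1 : 1 ≤ V) (hV : ∀ T ∈ Icc 1 B, (2 : ℝ) ^ #T.primeFactors ≤ V)
    (hV' : ∀ T ∈ Icc 1 (X + H), (2 : ℝ) ^ #T.primeFactors ≤ V)
    (hLV : ∑ T ∈ Icc 1 B, (T : ℝ)⁻¹ ≤ V) :
    ∑ d ∈ (Fintype.piFinset fun _ : ι => sqf B).filter (fun d => ¬ radT d ≤ B),
      |∑ n ∈ Ioc 0 X, ∏ i, psi H (d i ^ k) n| ≤
      6 ^ Fintype.card ι * V ^ (2 * Fintype.card ι + 1) *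
        ((H : ℝ) ^ Fintype.card ι * (X / y ^ (k - 1) + B)) := by
  set ℓ := Fintype.card ι
  calc _ ≤ ∑ d ∈ (Fintype.piFinset fun _ : ι => sqf B).filter (fun d => ¬ radT d ≤ B),
        ∑ n ∈ Ioc 0 X, ∑ h ∈ Fintype.piFinset (fun _ : ι => range H),
          ∏ i, wt k (d i) (n + h i) := by
        refine sum_le_sum fun d _ => (abs_sum_le_sum_abs _ _).trans (sum_le_sum fun n _ => ?_)
        rw [abs_prod]
        exact (prod_le_prod (fun _ _ => abs_nonneg _) fun i _ =>
          abs_psi_le_sum_wt k H (d i) n).trans_eq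
            (prod_univ_sum (fun _ => range H) fun i h => wt k (d i) (n + h))
    _ = ∑ n ∈ Ioc 0 X, ∑ h ∈ Fintype.piFinset (fun _ : ι => range H),
        ∑ d ∈ (Fintype.piFinset fun _ : ι => sqf B).filter (fun d => ¬ radT d ≤ B),
          ∏ i, wt k (d i) (n + h i) := by
        rw [sum_comm]
        exact sum_congr rfl fun n _ => sum_comm
    _ ≤ ∑ n ∈ Ioc 0 X, ∑ h ∈ Fintype.piFinset (fun _ : ι => range H),
          (V + 2) ^ ℓ * ∑ q ∈ coprimeTuples ι y B, ∏ i, wt k (q i) (n + h i) := by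
        refine sum_le_sum fun n hn => sum_le_sum fun h hh => ?_
        have hn' := mem_Ioc.mp hn
        have hh' : ∀ i, h i < H := fun i => mem_range.mp (Fintype.mem_piFinset.mp hh i)
        refine sum_prod_wt_large_le hk hy hyB (fun i => n + h i) (fun i => by omega) fun i => ?_
        have := hh' i
        exact hV' _ (mem_Icc.mpr ⟨by omega, by omega⟩)
    _ = (V + 2) ^ ℓ * ∑ h ∈ Fintype.piFinset (fun _ : ι => range H),
          ∑ q ∈ coprimeTuples ι y B, ∑ n ∈ Ioc 0 X, ∏ i, wt k (q i) (n + h i) := by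
        rw [sum_comm, mul_sum]
        refine sum_congr rfl fun h _ => ?_
        rw [← mul_sum, sum_comm]
    _ ≤ (V + 2) ^ ℓ * ∑ h ∈ Fintype.piFinset (fun _ : ι => range H),
          2 ^ ℓ * (V ^ (ℓ + 1) * (X / y ^ (k - 1) + B)) := by
        gcongr with h hh
        refine (sum_le_sum fun q hq => ?_).trans_eq (mul_sum _ _ _).symm |>.trans
          (mul_le_mul_of_nonneg_left (sum_coprimeTuples_le (ι := ι) (by omega : k ≠ 0) (X := X) hy hV1
            hV hLV) (by positivity))
        obtain ⟨hq1, hq2, -⟩ := mem_coprimeTuples.mp hq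
        refine sum_prod_wt_le (fun i => ?_) hq2 k X h
        have := (mem_sqf.mp (hq1 i)).1.1
        omega
    _ = ((V + 2) ^ ℓ * 2 ^ ℓ) * V ^ (ℓ + 1) * ((H : ℝ) ^ ℓ * (X / y ^ (k - 1) + B)) := by
        rw [sum_const, Fintype.card_piFinset, prod_const, card_range, card_univ, nsmul_eq_mul]
        push_cast; ring
    _ ≤ (6 ^ ℓ * V ^ ℓ) * V ^ (ℓ + 1) * ((H : ℝ) ^ ℓ * (X / y ^ (k - 1) + B)) := by
        have h6 : (V + 2) ^ ℓ * 2 ^ ℓ ≤ 6 ^ ℓ * V ^ ℓ := by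
          rw [← mul_pow, ← mul_pow]
          exact pow_le_pow_left₀ (by linarith) (by linarith) ℓ
        gcongr
    _ = _ := by ring

theorem sum_sqf_eq (k B H n : ℕ) :
    truncD k B H n = ∑ d ∈ sqf B, (moebius d : ℝ) * psi H (d ^ k) n := by
  rw [truncD, sqf, sum_filter]
  refine sum_congr rfl fun d _ => ?_
  split_ifs with h
  · rfl
  · simp [moebius_eq_zero_of_not_squarefree h]

/-! ### Moment bounds and choice of parameters. -/

theorem abs_sum_truncD_pow_le {k : ℕ} (hk : 2 ≤ k) (ℓ : ℕ) {B X H : ℕ} {y V R : ℝ} (hy : 1 ≤ y)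
    (hyB : y ^ 2 ≤ B) (hR : 1 ≤ R) (hRH : (R ^ 2) ^ k = H) (hV1 : 1 ≤ V)
    (hV : ∀ T ∈ Icc 1 B, (2 : ℝ) ^ #T.primeFactors ≤ V)
    (hV' : ∀ T ∈ Icc 1 (X + H), (2 : ℝ) ^ #T.primeFactors ≤ V)
    (hLV : ∑ T ∈ Icc 1 B, (T : ℝ)⁻¹ ≤ V) :
    |∑ n ∈ Ioc 0 X, truncD k B H n ^ ℓ| ≤
      2 * 6 ^ ℓ * V ^ (3 * ℓ + 1) * (X * R ^ ℓ + (H : ℝ) ^ ℓ * (X / y ^ (k - 1) + B)) := by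
  have h1 : ∀ n, truncD k B H n ^ ℓ = ∑ d ∈ Fintype.piFinset fun _ : Fin ℓ => sqf B,
      (∏ i, (moebius (d i) : ℝ)) * ∏ i, psi H (d i ^ k) n := by
    intro n
    rw [← Fin.prod_const ℓ (truncD k B H n), sum_sqf_eq, prod_univ_sum]
    exact sum_congr rfl fun d _ => prod_mul_distrib
  simp only [h1]
  rw [sum_comm]
  have h2 := sum_abs_small_le (ι := Fin ℓ) (X := X) (by omega : k ≠ 0) hR hRH hV1 hV hLV
  have h3 := sum_abs_large_le (ι := Fin ℓ) (X := X) (H := H) hk hy hyB hV1 hV hV' hLV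
  rw [Fintype.card_fin] at h2 h3
  calc _ ≤ ∑ d ∈ Fintype.piFinset fun _ : Fin ℓ => sqf B,
        |∑ n ∈ Ioc 0 X, ∏ i, psi H (d i ^ k) n| := by
        refine (abs_sum_le_sum_abs _ _).trans (sum_le_sum fun d _ => ?_)
        rw [← mul_sum, abs_mul, abs_prod]
        exact mul_le_of_le_one_left (abs_nonneg _)
          (prod_le_one (fun _ _ => abs_nonneg _) fun i _ => abs_moebius_cast_le (d i))
    _ ≤ 4 ^ ℓ * V ^ (3 * ℓ + 1) * (X * R ^ ℓ + (H : ℝ) ^ ℓ * B) +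
        6 ^ ℓ * V ^ (2 * ℓ + 1) * ((H : ℝ) ^ ℓ * (X / y ^ (k - 1) + B)) := by
        rw [← sum_filter_add_sum_filter_not _ (fun d => radT d ≤ B)]
        exact add_le_add h2 h3
    _ ≤ 6 ^ ℓ * V ^ (3 * ℓ + 1) * (X * R ^ ℓ + (H : ℝ) ^ ℓ * (X / y ^ (k - 1) + B)) +
        6 ^ ℓ * V ^ (3 * ℓ + 1) * (X * R ^ ℓ + (H : ℝ) ^ ℓ * (X / y ^ (k - 1) + B)) := by
        have e0 : (0 : ℝ) ≤ X / y ^ (k - 1) := by positivity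
        have e1 : (0 : ℝ) ≤ X * R ^ ℓ := by positivity
        gcongr
        · norm_num
        · linarith
        · omega
        · linarith
    _ = _ := by ring

end

theorem abs_moment_le_of_truncD {k : ℕ} (hk : 2 ≤ k) (ℓ : ℕ) {B X H : ℕ} (hB : 1 ≤ B)
    (hXB : X + H ≤ (B + 1) ^ k) :
    |∑ n ∈ Ioc 0 X, D k n H ^ ℓ| ≤
      |∑ n ∈ Ioc 0 X, truncD k B H n ^ ℓ| + ℓ * 4 ^ ℓ * ((H : ℝ) ^ ℓ * (X / (B : ℝ) ^ (k - 1))) := by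
  have hB1 : (1 : ℝ) ≤ (B : ℝ) ^ (k - 1) := one_le_pow₀ (by exact_mod_cast hB)
  have h1 : ∀ n ∈ Ioc 0 X, |D k n H ^ ℓ - truncD k B H n ^ ℓ| ≤
      ℓ * 4 ^ ℓ * (H : ℝ) ^ ℓ / (B : ℝ) ^ (k - 1) := by
    intro n hn
    obtain ⟨hn0, hnX⟩ := mem_Ioc.mp hn
    have h2 := abs_D_sub_truncD_le hk hB hn0 (show n + H ≤ (B + 1) ^ k by omega)
    have h3 := abs_D_le hk n H
    have h4 : (H : ℝ) / (B : ℝ) ^ (k - 1) ≤ H := div_le_self (by positivity) hB1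
    have h5 : |truncD k B H n| ≤ 4 * H := by
      have := abs_sub_abs_le_abs_sub (truncD k B H n) (D k n H)
      rw [abs_sub_comm] at this
      linarith
    rcases Nat.eq_zero_or_pos ℓ with rfl | hℓ
    · simp
    have h6 := abs_pow_sub_pow_le (D k n H) (truncD k B H n) ℓ
    have h7 : max |D k n H| |truncD k B H n| ≤ 4 * H :=
      max_le (h3.trans (by linarith [show (0 : ℝ) ≤ H by positivity])) h5
    calc _ ≤ |D k n H - truncD k B H n| * ℓ * max |D k n H| |truncD k B H n| ^ (ℓ - 1) := h6
      _ ≤ (H / (B : ℝ) ^ (k - 1)) * ℓ * (4 * H) ^ (ℓ - 1) := by gcongr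
      _ ≤ 4 * ((H / (B : ℝ) ^ (k - 1)) * ℓ * (4 * H) ^ (ℓ - 1)) := by
          have : 0 ≤ (H / (B : ℝ) ^ (k - 1)) * ℓ * (4 * H) ^ (ℓ - 1) := by positivity
          linarith
      _ = _ := by
          obtain ⟨j, rfl⟩ : ∃ j, ℓ = j + 1 := ⟨ℓ - 1, by omega⟩
          simp only [Nat.add_sub_cancel, mul_pow, pow_succ]; ring
  have h2 : |∑ n ∈ Ioc 0 X, (D k n H ^ ℓ - truncD k B H n ^ ℓ)| ≤
      X * (ℓ * 4 ^ ℓ * (H : ℝ) ^ ℓ / (B : ℝ) ^ (k - 1)) := by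
    refine (abs_sum_le_sum_abs _ _).trans ((sum_le_card_nsmul _ _ _ h1).trans_eq ?_)
    simp
  rw [sum_sub_distrib] at h2
  have h3 := abs_sub_abs_le_abs_sub (∑ n ∈ Ioc 0 X, D k n H ^ ℓ) (∑ n ∈ Ioc 0 X, truncD k B H n ^ ℓ)
  have e : (X : ℝ) * (ℓ * 4 ^ ℓ * (H : ℝ) ^ ℓ / (B : ℝ) ^ (k - 1)) =
      ℓ * 4 ^ ℓ * ((H : ℝ) ^ ℓ * (X / (B : ℝ) ^ (k - 1))) := by ring
  linarith

/-- Truncating at B ≍ H^(1/k) gives |D| ≤ 2B ≤ 8 H^(1/k). The resulting x H^(ℓ/k) is small enough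
because x < H and (k-1)/(k+1) + ℓ/k ≤ ℓ. -/
theorem abs_moment_le_of_lt {k : ℕ} (hk : 2 ≤ k) {ℓ : ℕ} (hℓ : 1 ≤ ℓ) {x : ℝ} {H : ℕ} (hx : 1 ≤ x)
    (hH : x < H) :
    |moment k x H ℓ| ≤ 8 ^ ℓ * ((H : ℝ) ^ ℓ * x ^ ((2 : ℝ) / ((k : ℝ) + 1))) := by
  have hk0 : (0 : ℝ) < k := by exact_mod_cast (by omega : 0 < k)
  have hk2 : (2 : ℝ) ≤ k := by exact_mod_cast hk
  have hℓ1 : (1 : ℝ) ≤ ℓ := by exact_mod_cast hℓ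
  have hH1 : (1 : ℝ) ≤ H := by linarith
  set v : ℝ := (2 * H : ℝ) ^ (1 / (k : ℝ)) with hv
  have hv1 : 1 ≤ v := Real.one_le_rpow (by linarith) (by positivity)
  have hvk : v ^ k = 2 * H := by
    rw [hv, ← Real.rpow_natCast, ← Real.rpow_mul (by positivity), one_div_mul_cancel hk0.ne',
      Real.rpow_one]
  have hvH : v ≤ 2 * (H : ℝ) ^ (1 / (k : ℝ)) := by
    rw [hv, Real.mul_rpow (by norm_num) (by positivity)]
    gcongr
    calc (2 : ℝ) ^ (1 / (k : ℝ)) ≤ 2 ^ (1 : ℝ) :=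
          Real.rpow_le_rpow_of_exponent_le (by norm_num) (by rw [div_le_one hk0]; linarith)
      _ = 2 := Real.rpow_one 2
  set B := ⌈v⌉₊ with hBdef
  have hvB : v ≤ B := Nat.le_ceil v
  have hBv : (B : ℝ) ≤ 2 * v := by
    have := Nat.ceil_lt_add_one (show 0 ≤ v by linarith)
    rw [hBdef]; linarith
  have hB1 : 1 ≤ B := by
    have : (1 : ℝ) ≤ B := by linarith
    exact_mod_cast this
  have hBk : (2 * H : ℝ) ≤ (B : ℝ) ^ k := by rw [← hvk]; gcongr
  have hfl : (⌊x⌋₊ : ℝ) ≤ x := Nat.floor_le (by linarith)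
  have hD : ∀ n ∈ Ioc 0 ⌊x⌋₊, |D k n H ^ ℓ| ≤ (8 * (H : ℝ) ^ (1 / (k : ℝ))) ^ ℓ := by
    intro n hn
    obtain ⟨hn0, hnX⟩ := mem_Ioc.mp hn
    have hnx : (n : ℝ) ≤ x := le_trans (by exact_mod_cast hnX) hfl
    have h1 : n + H ≤ (B + 1) ^ k := by
      have : ((n + H : ℕ) : ℝ) ≤ ((B + 1 : ℕ) : ℝ) ^ k := by
        push_cast
        calc (n : ℝ) + H ≤ (B : ℝ) ^ k := by linarith
          _ ≤ ((B : ℝ) + 1) ^ k := by gcongr; linarith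
      exact_mod_cast this
    have h2 := abs_D_sub_truncD_le hk hB1 hn0 h1
    have h3 := abs_truncD_le (k := k) B H n
    have h4 : (H : ℝ) / (B : ℝ) ^ (k - 1) ≤ B := by
      have hB0 : (0 : ℝ) < B := by linarith
      rw [div_le_iff₀ (by positivity), ← pow_succ', show k - 1 + 1 = k by omega]
      linarith
    have h5 := abs_sub_abs_le_abs_sub (D k n H) (truncD k B H n)
    rw [abs_pow]
    gcongr
    linarith
  have hsum : |moment k x H ℓ| ≤ x * (8 * (H : ℝ) ^ (1 / (k : ℝ))) ^ ℓ := by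
    refine (abs_sum_le_sum_abs _ _).trans ((sum_le_card_nsmul _ _ _ hD).trans ?_)
    rw [Nat.card_Ioc, nsmul_eq_mul, Nat.sub_zero]
    gcongr
  refine hsum.trans ?_
  have hx0 : 0 < x := by linarith
  have hH0 : (0 : ℝ) < H := by linarith
  have e1 : x = x ^ ((2 : ℝ) / ((k : ℝ) + 1)) * x ^ (((k : ℝ) - 1) / ((k : ℝ) + 1)) := by
    rw [← Real.rpow_add hx0, ← add_div]
    have : (2 + ((k : ℝ) - 1)) / ((k : ℝ) + 1) = 1 := by
      rw [div_eq_one_iff_eq (by positivity)]; ring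
    rw [this, Real.rpow_one]
  have e2 : ((H : ℝ) ^ (1 / (k : ℝ))) ^ ℓ = (H : ℝ) ^ ((ℓ : ℝ) / k) := by
    rw [← Real.rpow_natCast, ← Real.rpow_mul (by positivity)]; congr 1; ring
  have h6 : x ^ (((k : ℝ) - 1) / ((k : ℝ) + 1)) ≤ (H : ℝ) ^ (((k : ℝ) - 1) / ((k : ℝ) + 1)) :=
    Real.rpow_le_rpow (by positivity) hH.le (div_nonneg (by linarith) (by positivity))
  have h7 : (H : ℝ) ^ (((k : ℝ) - 1) / ((k : ℝ) + 1)) * (H : ℝ) ^ ((ℓ : ℝ) / k) ≤ (H : ℝ) ^ ℓ := by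
    rw [← Real.rpow_add hH0, ← Real.rpow_natCast]
    refine Real.rpow_le_rpow_of_exponent_le hH1 ?_
    have h8 : ((k : ℝ) - 1) / ((k : ℝ) + 1) ≤ ((k : ℝ) - 1) / k := by
      gcongr
      · linarith
      · linarith
    have h9 : ((k : ℝ) - 1) / k ≤ ((k : ℝ) - 1) / k * ℓ :=
      le_mul_of_one_le_right (div_nonneg (by linarith) hk0.le) hℓ1
    have h10 : ((k : ℝ) - 1) / k * ℓ + ℓ / k = ℓ := by field_simp; ring
    linarith
  calc x * (8 * (H : ℝ) ^ (1 / (k : ℝ))) ^ ℓ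
      = 8 ^ ℓ * (x ^ ((2 : ℝ) / ((k : ℝ) + 1)) *
          (x ^ (((k : ℝ) - 1) / ((k : ℝ) + 1)) * (H : ℝ) ^ ((ℓ : ℝ) / k))) := by
        rw [mul_pow, e2]; nth_rewrite 1 [e1]; ring
    _ ≤ 8 ^ ℓ * (x ^ ((2 : ℝ) / ((k : ℝ) + 1)) *
          ((H : ℝ) ^ (((k : ℝ) - 1) / ((k : ℝ) + 1)) * (H : ℝ) ^ ((ℓ : ℝ) / k))) := by gcongr
    _ ≤ 8 ^ ℓ * (x ^ ((2 : ℝ) / ((k : ℝ) + 1)) * (H : ℝ) ^ ℓ) := by gcongr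
    _ = _ := by ring

theorem abs_moment_le_of_le {ε : ℝ} (hε : 0 < ε) {k : ℕ} (hk : 2 ≤ k) (ℓ : ℕ) :
    ∃ C : ℝ, 0 < C ∧ ∀ (x : ℝ) (H : ℕ), 1 ≤ x → 1 ≤ H → (H : ℝ) ≤ x →
      |moment k x H ℓ| ≤
        C * (x ^ ε * ((H : ℝ) ^ ((ℓ : ℝ) / (2 * (k : ℝ))) * x +
          (H : ℝ) ^ ℓ * x ^ ((2 : ℝ) / ((k : ℝ) + 1)))) := by
  -- V, a multiple of x^δ bounding both the divisor factors and the harmonic sum, enters to the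
  -- power 3ℓ + 1.
  set δ : ℝ := ε / (3 * ℓ + 1) with hδ
  have hδ0 : 0 < δ := by positivity
  obtain ⟨C₁, hC₁, hω⟩ := two_pow_card_primeFactors_le hδ0
  obtain ⟨C₂, hC₂, hL⟩ := sum_Icc_inv_le hδ0
  set K : ℝ := C₁ * C₂ * 2 ^ δ with hK
  have h2δ : (1 : ℝ) ≤ 2 ^ δ := Real.one_le_rpow (by norm_num) hδ0.le
  have hK1 : 1 ≤ K := one_le_mul_of_one_le_of_one_le (one_le_mul_of_one_le_of_one_le hC₁ hC₂) h2δ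
  refine ⟨2 * 6 ^ ℓ * K ^ (3 * ℓ + 1) * 3 + ℓ * 4 ^ ℓ, by positivity, fun x H hx hH hHx => ?_⟩
  have hx0 : 0 < x := by linarith
  have hk0 : (0 : ℝ) < k := by exact_mod_cast (by omega : 0 < k)
  have hH1 : (1 : ℝ) ≤ H := by exact_mod_cast hH
  set y : ℝ := x ^ (1 / ((k : ℝ) + 1)) with hy
  have hy1 : 1 ≤ y := Real.one_le_rpow hx (by positivity)
  have hyk : y ^ (k + 1) = x := by
    rw [hy, ← Real.rpow_natCast, ← Real.rpow_mul hx0.le]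
    push_cast
    rw [one_div_mul_cancel (by positivity), Real.rpow_one]
  have hy2 : y ^ 2 = x ^ ((2 : ℝ) / ((k : ℝ) + 1)) := by
    rw [hy, ← Real.rpow_natCast, ← Real.rpow_mul hx0.le]; congr 1; push_cast; ring
  have hy2x : y ^ 2 ≤ x := by
    rw [← hyk]; exact pow_le_pow_right₀ hy1 (by omega)
  have hysq : 1 ≤ y ^ 2 := one_le_pow₀ hy1
  -- The factor 2 ensures y² ≤ B despite the rounding, and X + H ≤ 2x ≤ (B + 1)^k.
  set B := ⌊2 * y ^ 2⌋₊ with hBdef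
  have hB2 : (B : ℝ) ≤ 2 * y ^ 2 := Nat.floor_le (by positivity)
  have hB3 : 2 * y ^ 2 < B + 1 := Nat.lt_floor_add_one _
  have hByy : y ^ 2 ≤ B := by linarith
  have hB1 : 1 ≤ B := by
    have : (1 : ℝ) ≤ B := by linarith
    exact_mod_cast this
  set X := ⌊x⌋₊ with hX
  have hXx : (X : ℝ) ≤ x := Nat.floor_le hx0.le
  have hXB : X + H ≤ (B + 1) ^ k := by
    have : ((X + H : ℕ) : ℝ) ≤ ((B + 1 : ℕ) : ℝ) ^ k := by
      push_cast
      calc (X : ℝ) + H ≤ 2 ^ 1 * x := by linarith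
        _ ≤ 2 ^ k * x :=
            mul_le_mul_of_nonneg_right (pow_le_pow_right₀ (by norm_num) (by omega)) hx0.le
        _ ≤ 2 ^ k * (y ^ 2) ^ k := by
            gcongr
            rw [← hyk, ← pow_mul]
            exact pow_le_pow_right₀ hy1 (by omega)
        _ = (2 * y ^ 2) ^ k := (mul_pow _ _ _).symm
        _ ≤ ((B : ℝ) + 1) ^ k := by gcongr
    exact_mod_cast this
  set R : ℝ := (H : ℝ) ^ (1 / (2 * (k : ℝ))) with hR
  have hR1 : 1 ≤ R := Real.one_le_rpow hH1 (by positivity)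
  have hRH : (R ^ 2) ^ k = H := by
    rw [← pow_mul, hR, ← Real.rpow_natCast, ← Real.rpow_mul (by positivity)]
    push_cast
    rw [one_div_mul_cancel (by positivity), Real.rpow_one]
  have hRℓ : R ^ ℓ = (H : ℝ) ^ ((ℓ : ℝ) / (2 * (k : ℝ))) := by
    rw [hR, ← Real.rpow_natCast, ← Real.rpow_mul (by positivity)]; congr 1; ring
  have hxδ : 1 ≤ x ^ δ := Real.one_le_rpow hx hδ0.le
  set V : ℝ := K * x ^ δ with hVdef
  have hV1 : 1 ≤ V := one_le_mul_of_one_le_of_one_le hK1 hxδ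
  have hVε : V ^ (3 * ℓ + 1) = K ^ (3 * ℓ + 1) * x ^ ε := by
    rw [hVdef, mul_pow, ← Real.rpow_natCast (x ^ δ), ← Real.rpow_mul hx0.le, hδ]
    push_cast
    rw [div_mul_cancel₀ _ (by positivity)]
  have hVx : ∀ T : ℕ, (T : ℝ) ≤ 2 * x → (T : ℝ) ^ δ ≤ 2 ^ δ * x ^ δ := by
    intro T hT
    rw [← Real.mul_rpow (by norm_num) hx0.le]
    exact Real.rpow_le_rpow (by positivity) hT hδ0.le
  have hωV : ∀ T : ℕ, T ≠ 0 → (T : ℝ) ≤ 2 * x → (2 : ℝ) ^ #T.primeFactors ≤ V := by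
    intro T h0 hT
    calc (2 : ℝ) ^ #T.primeFactors ≤ C₁ * (T : ℝ) ^ δ := hω T h0
      _ ≤ C₁ * (2 ^ δ * x ^ δ) := by gcongr; exact hVx T hT
      _ ≤ C₂ * (C₁ * (2 ^ δ * x ^ δ)) := le_mul_of_one_le_left (by positivity) hC₂
      _ = V := by rw [hVdef, hK]; ring
  have hBx : (B : ℝ) ≤ 2 * x := by linarith
  have hLV : ∑ T ∈ Icc 1 B, (T : ℝ)⁻¹ ≤ V := by
    calc _ ≤ C₂ * (B : ℝ) ^ δ := hL B hB1
      _ ≤ C₂ * (2 ^ δ * x ^ δ) := by gcongr; exact hVx B hBx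
      _ ≤ C₁ * (C₂ * (2 ^ δ * x ^ δ)) := le_mul_of_one_le_left (by positivity) hC₁
      _ = V := by rw [hVdef, hK]; ring
  have hV : ∀ T ∈ Icc 1 B, (2 : ℝ) ^ #T.primeFactors ≤ V := by
    intro T hT
    obtain ⟨h1, h2⟩ := mem_Icc.mp hT
    have h3 : (T : ℝ) ≤ B := by exact_mod_cast h2
    exact hωV T (by omega) (by linarith)
  have hV' : ∀ T ∈ Icc 1 (X + H), (2 : ℝ) ^ #T.primeFactors ≤ V := by
    intro T hT
    obtain ⟨h1, h2⟩ := mem_Icc.mp hT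
    have h3 : (T : ℝ) ≤ X + H := by exact_mod_cast h2
    exact hωV T (by omega) (by linarith)
  have hm1 := abs_sum_truncD_pow_le hk ℓ (X := X) hy1 hByy hR1 hRH hV1 hV hV' hLV
  have hm2 := abs_moment_le_of_truncD hk ℓ hB1 hXB
  have hdiv : (X : ℝ) / y ^ (k - 1) ≤ y ^ 2 := by
    rw [div_le_iff₀ (by positivity), ← pow_add, show 2 + (k - 1) = k + 1 by omega, hyk]
    exact hXx
  have hdiv' : (X : ℝ) / (B : ℝ) ^ (k - 1) ≤ y ^ 2 := by
    refine le_trans ?_ hdiv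
    have : y ≤ B := by nlinarith
    gcongr
  have hxε : 1 ≤ x ^ ε := Real.one_le_rpow hx hε.le
  rw [← hy2, ← hRℓ]
  have hHy : 0 ≤ (H : ℝ) ^ ℓ * y ^ 2 := by positivity
  have hRx : 0 ≤ R ^ ℓ * x := by positivity
  calc |moment k x H ℓ| ≤ 2 * 6 ^ ℓ * V ^ (3 * ℓ + 1) *
        (X * R ^ ℓ + (H : ℝ) ^ ℓ * (X / y ^ (k - 1) + B)) +
        ℓ * 4 ^ ℓ * ((H : ℝ) ^ ℓ * (X / (B : ℝ) ^ (k - 1))) :=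
        hm2.trans (add_le_add_left hm1 _)
    _ ≤ 2 * 6 ^ ℓ * V ^ (3 * ℓ + 1) * (x * R ^ ℓ + (H : ℝ) ^ ℓ * (y ^ 2 + 2 * y ^ 2)) +
        ℓ * 4 ^ ℓ * ((H : ℝ) ^ ℓ * y ^ 2) := by gcongr
    _ ≤ 2 * 6 ^ ℓ * V ^ (3 * ℓ + 1) * (3 * (R ^ ℓ * x + (H : ℝ) ^ ℓ * y ^ 2)) +
        ℓ * 4 ^ ℓ * (x ^ ε * (R ^ ℓ * x + (H : ℝ) ^ ℓ * y ^ 2)) := by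
        have h1 : x * R ^ ℓ + (H : ℝ) ^ ℓ * (y ^ 2 + 2 * y ^ 2) ≤
            3 * (R ^ ℓ * x + (H : ℝ) ^ ℓ * y ^ 2) := by linarith
        have h2 : (H : ℝ) ^ ℓ * y ^ 2 ≤ x ^ ε * (R ^ ℓ * x + (H : ℝ) ^ ℓ * y ^ 2) :=
          le_trans (by linarith) (le_mul_of_one_le_left (by linarith) hxε)
        gcongr
    _ = _ := by rw [hVε]; ring

theorem abs_moment_le {ε : ℝ} (hε : 0 < ε) {k : ℕ} (hk : 2 ≤ k) {ℓ : ℕ} (hℓ : 1 ≤ ℓ) :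
    ∃ C : ℝ, 0 < C ∧ ∀ (x : ℝ) (H : ℕ), 0 < x → 1 ≤ H →
      |moment k x H ℓ| ≤
        C * (x ^ ε * ((H : ℝ) ^ ((ℓ : ℝ) / (2 * (k : ℝ))) * x +
          (H : ℝ) ^ ℓ * x ^ ((2 : ℝ) / ((k : ℝ) + 1)))) := by
  obtain ⟨C, hC, h⟩ := abs_moment_le_of_le hε hk ℓ
  refine ⟨C + 8 ^ ℓ, by positivity, fun x H hx hH => ?_⟩
  rcases lt_or_ge x 1 with hx1 | hx1
  · have : moment k x H ℓ = 0 := by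
      rw [moment, Nat.floor_eq_zero.mpr hx1]; simp
    rw [this, abs_zero]
    positivity
  rw [add_mul]
  rcases le_or_gt (H : ℝ) x with hHx | hHx
  · exact (h x H hx1 hH hHx).trans (le_add_of_nonneg_right (by positivity))
  · refine (abs_moment_le_of_lt hk hℓ hx1 hHx).trans
      (le_trans ?_ (le_add_of_nonneg_left (by positivity)))
    have hxε : 1 ≤ x ^ ε := Real.one_le_rpow hx1 hε.le
    refine mul_le_mul_of_nonneg_left ?_ (by positivity)
    exact le_trans (le_add_of_nonneg_left (by positivity))
      (le_mul_of_one_le_left (by positivity) hxε)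

/-- The exponent c_k is the one that balances the two terms: the excess power s = ℓ(2k-1)/(2k) of H
satisfies s c_k/ℓ = (k-1)/(k+1) = 1 - 2/(k+1). -/
theorem pow_mul_rpow_le_of_le_rpow {k : ℕ} (hk : 2 ≤ k) {ℓ : ℕ} (hℓ : 1 ≤ ℓ) {x : ℝ} {H : ℕ}
    (hx : 0 < x) (hH : 1 ≤ H) (hHx : (H : ℝ) ≤ x ^ (c k / (ℓ : ℝ))) :
    (H : ℝ) ^ ℓ * x ^ ((2 : ℝ) / ((k : ℝ) + 1)) ≤ (H : ℝ) ^ ((ℓ : ℝ) / (2 * (k : ℝ))) * x := by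
  have hk2 : (2 : ℝ) ≤ k := by exact_mod_cast hk
  have hℓ0 : (0 : ℝ) < ℓ := by exact_mod_cast hℓ
  have hH0 : (0 : ℝ) < H := by exact_mod_cast hH
  have hd : (0 : ℝ) < 2 * k - 1 := by linarith
  set s : ℝ := ℓ * (2 * k - 1) / (2 * k) with hs
  have hs0 : 0 ≤ s := by positivity
  have h1 : (H : ℝ) ^ s ≤ x ^ (((k : ℝ) - 1) / ((k : ℝ) + 1)) := by
    refine (Real.rpow_le_rpow hH0.le hHx hs0).trans_eq ?_
    rw [← Real.rpow_mul hx.le]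
    congr 1
    rw [c, hs]; field_simp
  have h2 : (H : ℝ) ^ ℓ = (H : ℝ) ^ ((ℓ : ℝ) / (2 * (k : ℝ))) * (H : ℝ) ^ s := by
    rw [← Real.rpow_add hH0, ← Real.rpow_natCast]
    congr 1
    rw [hs]; field_simp; ring
  have h3 : x = x ^ (((k : ℝ) - 1) / ((k : ℝ) + 1)) * x ^ ((2 : ℝ) / ((k : ℝ) + 1)) := by
    rw [← Real.rpow_add hx, ← add_div]
    have : (((k : ℝ) - 1) + 2) / ((k : ℝ) + 1) = 1 := by
      rw [div_eq_one_iff_eq (by positivity)]; ring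
    rw [this, Real.rpow_one]
  rw [h2]
  nth_rewrite 2 [h3]
  rw [mul_assoc]
  gcongr

end KFree

theorem theorem1 (ε : ℝ) (hε : 0 < ε) (k : ℕ) (hk : 2 ≤ k) (ℓ : ℕ) (hℓ : 3 ≤ ℓ) :
    (∃ C : ℝ, 0 < C ∧ ∀ (x : ℝ) (H : ℕ), 0 < x → 1 ≤ H →
      |KFree.moment k x H ℓ| ≤
        C * (x ^ ε * ((H : ℝ) ^ ((ℓ : ℝ) / (2 * (k : ℝ))) * x +
          (H : ℝ) ^ ℓ * x ^ ((2 : ℝ) / ((k : ℝ) + 1))))) ∧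
    (∃ C : ℝ, 0 < C ∧ ∀ (x : ℝ) (H : ℕ), 0 < x → 1 ≤ H →
      (H : ℝ) ≤ x ^ (KFree.c k / (ℓ : ℝ)) →
      |KFree.moment k x H ℓ| ≤
        C * (x ^ (1 + ε) * (H : ℝ) ^ ((ℓ : ℝ) / (2 * (k : ℝ))))) := by
  obtain ⟨C, hC, h⟩ := KFree.abs_moment_le hε hk (show 1 ≤ ℓ by omega)
  refine ⟨⟨C, hC, h⟩, 2 * C, by positivity, fun x H hx hH hHx => (h x H hx hH).trans ?_⟩
  have h1 := KFree.pow_mul_rpow_le_of_le_rpow hk (show 1 ≤ ℓ by omega) hx hH hHx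
  rw [Real.rpow_add hx, Real.rpow_one]
  calc _ ≤ C * (x ^ ε * ((H : ℝ) ^ ((ℓ : ℝ) / (2 * (k : ℝ))) * x +
          (H : ℝ) ^ ((ℓ : ℝ) / (2 * (k : ℝ))) * x)) := by gcongr
    _ = _ := by ring
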